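/- Let $(A,\Delta)$ be a regular weak multiplier Hopf algebra over $\mathbb C$ (in the sense of Van Daele and Wang): $A$ is a non-degenerate idempotent algebra, $\Delta:A\to M(A\otimes A)$ is a full regular coproduct with counit $\varepsilon$ and canonical idempotent $E\in M(A\otimes A)$, and the antipode $S$ is a bijective linear map from $A$ to $A$. The coproduct being regular means that $\Delta(a)(1\otimes b)$, $(b\otimes 1)\Delta(a)$, $(1\otimes b)\Delta(a)$ and $\Delta(a)(b\otimes 1)$ all lie in $A\otimes A$ for $a,b\in A$. Let $\varepsilon_t(A)$ and $\varepsilon_s(A)$ be the images in $M(A)$ of the target and source maps $$\varepsilon_t(a)=\sum_{(a)}a_{(1)}S(a_{(2)}),\qquad \varepsilon_s(a)=\sum_{(a)}S(a_{(1)})a_{(2)},$$ and let $A_t=M(\varepsilon_t(A))$ and $A_s=M(\varepsilon_s(A))$ be their multiplier algebras, viewed inside $M(A)$, that is, $A_t=\{x\in M(A): x\,\varepsilon_t(A)\subseteq\varepsilon_t(A),\ \varepsilon_t(A)\,x\subseteq\varepsilon_t(A)\}$ and similarly for $A_s$. For a linear functional $\omega$ on $A$ and $a\in A$, the multiplier $x=(\iota\otimes\omega)\Delta(a)\in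 M(A)$ is given by $xb=(\iota\otimes\omega)(\Delta(a)(b\otimes1))$ and $bx=(\iota\otimes\omega)((b\otimes1)\Delta(a))$ for $b\in A$, and $(\omega\otimes\iota)\Delta(a)\in M(A)$ is defined similarly. A linear functional $\varphi$ on $A$ is called left invariant if $(\iota\otimes\varphi)\Delta(a)\in A_t$ for all $a\in A$, and a linear functional $\psi$ on $A$ is called right invariant if $(\psi\otimes\iota)\Delta(a)\in A_s$ for all $a\in A$. 1. A linear functional $\varphi$ on $A$ is left invariant if and only if $$(\iota\otimes\varphi)((1\otimes a)\Delta(b))=S\big((\iota\otimes\varphi)(\Delta(a)(1\otimes b))\big)\qquad\text{for all }a,b\in A.$$ 2. A linear functional $\psi$ on $A$ is right invariant if and only if $$(\psi\otimes\iota)(\Delta(a)(b\otimes 1))=S\big((\psi\otimes\iota)((a\otimes 1)\Delta(b))\big)\qquad\text{for all }a,b\in A.$$ 3. If $\varphi$ is left invariant (in particular, if $\varphi$ is a left integral, i.e. a non-zero left invariant functional), then $(\iota\otimes\varphi)\Delta(a)\in\varepsilon_t(A)$ for all $a\in A$. If $\psi$ is right invariant, then $(\psi\otimes\iota)\Delta(a)\in\varepsilon_s(A)$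 for all $a\in A$. -/

import Mathlib

open scoped TensorProduct

set_option linter.unusedSectionVars false

noncomputable section

section Multipliers

/-- The product of `A` is non-degenerate (as a bilinear map). -/
def IsNondegenerateProduct (A : Type*) [NonUnitalRing A] : Prop :=
  (∀ a : A, (∀ b : A, a * b = 0) → a = 0) ∧ (∀ a : A, (∀ b : A, b * a = 0) → a = 0)

variable (A : Type*) [NonUnitalRing A] [Module ℂ A] [IsScalarTower ℂ A A] [SMulCommClass ℂ A A]
variable (B : Type*) [NonUnitalRing B] [Module ℂ B] [IsScalarTower ℂ B B] [SMulCommClass ℂ B B]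

/-- The algebra of two-sided multipliers of `A`. A multiplier `m` is a pair of linear maps
`b ↦ m b` and `a ↦ a m` from `A` to `A` such that `(a m) b = a (m b)`. The second map is kept in
the opposite algebra, so that the product of the ambient algebra is the product of multipliers:
`(m n) b = m (n b)` and `a (m n) = (a m) n`. -/
def multiplierSubalgebra :
    Subalgebra ℂ (Module.End ℂ A × (Module.End ℂ A)ᵐᵒᵖ) where
  carrier := {p | ∀ a b : A, p.2.unop a * b = a * p.1 b}
  mul_mem' := by
    intro p q hp hq a b
    change ∀ a b : A, _ = _ at hp
    change ∀ a b : A, _ = _ at hq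
    simp [hp, hq]
  add_mem' := by
    intro p q hp hq a b
    change ∀ a b : A, _ = _ at hp
    change ∀ a b : A, _ = _ at hq
    simp [hp, hq, add_mul, mul_add]
  algebraMap_mem' := by
    intro r a b
    change (r • a) * b = a * (r • b)
    rw [smul_mul_assoc, mul_smul_comm]

/-- The multiplier algebra `M(A)`. -/
def Multiplier : Type _ := ↥(multiplierSubalgebra A)

instance : Ring (Multiplier A) := inferInstanceAs (Ring ↥(multiplierSubalgebra A))

instance : Algebra ℂ (Multiplier A) := inferInstanceAs (Algebra ℂ ↥(multiplierSubalgebra A))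

namespace Multiplier

variable {A B}

/-- Left multiplication `b ↦ m b` by a multiplier `m`. -/
def left (m : Multiplier A) : A →ₗ[ℂ] A := m.1.1

/-- Right multiplication `a ↦ a m` by a multiplier `m`. -/
def right (m : Multiplier A) : A →ₗ[ℂ] A := m.1.2.unop

theorem right_mul_eq (m : Multiplier A) (a b : A) : m.right a * b = a * m.left b := m.2 a b

/-- The multiplier with prescribed left and right multiplications. -/
def mk (l r : A →ₗ[ℂ] A) (h : ∀ a b : A, r a * b = a * l b) : Multiplier A :=
  ⟨(l, MulOpposite.op r), h⟩

@[simp] theorem left_mk (l r : A →ₗ[ℂ] A) (h : ∀ a b : A, r a * b = a * l b) :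
    (mk l r h).left = l := rfl

@[simp] theorem right_mk (l r : A →ₗ[ℂ] A) (h : ∀ a b : A, r a * b = a * l b) :
    (mk l r h).right = r := rfl

theorem ext' {m n : Multiplier A} (hl : m.left = n.left) (hr : m.right = n.right) : m = n :=
  Subtype.ext (Prod.ext hl (MulOpposite.unop_injective hr))

@[simp] theorem left_mul (m n : Multiplier A) (a : A) : (m * n).left a = m.left (n.left a) := rfl

@[simp] theorem right_mul (m n : Multiplier A) (a : A) :
    (m * n).right a = n.right (m.right a) := rfl

@[simp] theorem left_one (a : A) : (1 : Multiplier A).left a = a := rfl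

@[simp] theorem right_one (a : A) : (1 : Multiplier A).right a = a := rfl

@[simp] theorem left_add (m n : Multiplier A) : (m + n).left = m.left + n.left := rfl

@[simp] theorem right_add (m n : Multiplier A) : (m + n).right = m.right + n.right := rfl

@[simp] theorem left_smul (r : ℂ) (m : Multiplier A) : (r • m).left = r • m.left := rfl

@[simp] theorem right_smul (r : ℂ) (m : Multiplier A) : (r • m).right = r • m.right := rfl

/-- The canonical homomorphism from `A` to `M(A)`. -/
def of : A →ₗ[ℂ] Multiplier A where
  toFun a := mk (LinearMap.mulLeft ℂ a) (LinearMap.mulRight ℂ a) fun x y => by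
    simp [mul_assoc]
  map_add' a b := ext' (LinearMap.ext fun x => add_mul a b x)
    (LinearMap.ext fun x => mul_add x a b)
  map_smul' r a := ext' (LinearMap.ext fun x => smul_mul_assoc r a x)
    (LinearMap.ext fun x => mul_smul_comm r x a)

@[simp] theorem left_of (a b : A) : (of a).left b = a * b := rfl

@[simp] theorem right_of (a b : A) : (of a).right b = b * a := rfl

theorem mul_left_assoc (hA : IsNondegenerateProduct A) (m : Multiplier A) (a b : A) :
    m.left (a * b) = m.left a * b := by
  rw [← sub_eq_zero]
  apply hA.2
  intro c
  rw [mul_sub, sub_eq_zero, ← right_mul_eq, ← mul_assoc, ← mul_assoc, right_mul_eq]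

theorem mul_right_assoc (hA : IsNondegenerateProduct A) (m : Multiplier A) (a b : A) :
    m.right (a * b) = a * m.right b := by
  rw [← sub_eq_zero]
  apply hA.1
  intro c
  rw [sub_mul, sub_eq_zero, right_mul_eq, mul_assoc, mul_assoc, right_mul_eq]

/-- `of (m a) = m * of a`. -/
theorem of_left (hA : IsNondegenerateProduct A) (m : Multiplier A) (a : A) :
    of (m.left a) = m * of a :=
  ext' (LinearMap.ext fun b => (mul_left_assoc hA m a b).symm)
    (LinearMap.ext fun b => (right_mul_eq m b a).symm)

/-- `of (a m) = of a * m`. -/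
theorem of_right (hA : IsNondegenerateProduct A) (m : Multiplier A) (a : A) :
    of (m.right a) = of a * m :=
  ext' (LinearMap.ext fun b => right_mul_eq m a b)
    (LinearMap.ext fun b => (mul_right_assoc hA m b a).symm)

/-- The multiplier `m ⊗ n` of `A ⊗ B`, for multipliers `m` of `A` and `n` of `B`. -/
def tmul : Multiplier A →ₗ[ℂ] Multiplier B →ₗ[ℂ] Multiplier (A ⊗[ℂ] B) :=
  LinearMap.mk₂ ℂ
    (fun m n => mk (TensorProduct.map m.left n.left) (TensorProduct.map m.right n.right) (by
      intro x y
      induction x with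
      | zero => simp
      | add x x' hx hx' => simp [add_mul, hx, hx']
      | tmul a b =>
        induction y with
        | zero => simp
        | add y y' hy hy' => rw [mul_add, hy, hy', map_add, mul_add]
        | tmul c d => simp [right_mul_eq]))
    (fun m m' n => ext' (by simp [TensorProduct.map_add_left])
      (by simp [TensorProduct.map_add_left]))
    (fun r m n => ext' (by simp [TensorProduct.map_smul_left])
      (by simp [TensorProduct.map_smul_left]))
    (fun m n n' => ext' (by simp [TensorProduct.map_add_right])
      (by simp [TensorProduct.map_add_right]))
    (fun r m n => ext' (by simp [TensorProduct.map_smul_right])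
      (by simp [TensorProduct.map_smul_right]))

@[simp] theorem left_tmul (m : Multiplier A) (n : Multiplier B) :
    (tmul m n).left = TensorProduct.map m.left n.left := rfl

@[simp] theorem right_tmul (m : Multiplier A) (n : Multiplier B) :
    (tmul m n).right = TensorProduct.map m.right n.right := rfl

/-- Transport of multipliers along an isomorphism of algebras. -/
def conj (e : A ≃ₗ[ℂ] B) (he : ∀ x y : A, e (x * y) = e x * e y) :
    Multiplier A →ₗ[ℂ] Multiplier B where
  toFun m := mk (e.toLinearMap ∘ₗ m.left ∘ₗ e.symm.toLinearMap)
    (e.toLinearMap ∘ₗ m.right ∘ₗ e.symm.toLinearMap) (by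
      intro x y
      obtain ⟨x, rfl⟩ := e.surjective x
      obtain ⟨y, rfl⟩ := e.surjective y
      simp [← he, right_mul_eq])
  map_add' m n := ext' (by ext; simp) (by ext; simp)
  map_smul' r m := ext' (by ext; simp) (by ext; simp)

@[simp] theorem left_conj (e : A ≃ₗ[ℂ] B) (he : ∀ x y : A, e (x * y) = e x * e y)
    (m : Multiplier A) :
    (conj e he m).left = e.toLinearMap ∘ₗ m.left ∘ₗ e.symm.toLinearMap := rfl

@[simp] theorem right_conj (e : A ≃ₗ[ℂ] B) (he : ∀ x y : A, e (x * y) = e x * e y)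
    (m : Multiplier A) :
    (conj e he m).right = e.toLinearMap ∘ₗ m.right ∘ₗ e.symm.toLinearMap := rfl

/-- Let `f : B → M(A)` be a homomorphism, possibly degenerate, and let `e` be the idempotent of
`M(A)` that plays the role of `f 1`. The multiplier `y` of `A` is the value at the multiplier `m`
of `B` of the extension of `f` to `M(B)` with `f 1 = e`. -/
def IsExtensionValue (f : B →ₗ[ℂ] Multiplier A) (e : Multiplier A) (m : Multiplier B)
    (y : Multiplier A) : Prop :=
  (∀ x : B, y * f x = f (m.left x)) ∧ (∀ x : B, f x * y = f (m.right x)) ∧ e * y = y ∧ y * e = y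

end Multiplier

end Multipliers

section Legs

variable {A : Type*} [NonUnitalRing A] [Module ℂ A]

/-- The map `ι ⊗ φ : A ⊗ A → A` for a linear functional `φ`. -/
def sliceSnd (φ : A →ₗ[ℂ] ℂ) : A ⊗[ℂ] A →ₗ[ℂ] A :=
  (TensorProduct.rid ℂ A).toLinearMap ∘ₗ φ.lTensor A

/-- The map `φ ⊗ ι : A ⊗ A → A` for a linear functional `φ`. -/
def sliceFst (φ : A →ₗ[ℂ] ℂ) : A ⊗[ℂ] A →ₗ[ℂ] A :=
  (TensorProduct.lid ℂ A).toLinearMap ∘ₗ φ.rTensor A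

@[simp] theorem sliceSnd_tmul (φ : A →ₗ[ℂ] ℂ) (a b : A) : sliceSnd φ (a ⊗ₜ b) = φ b • a := by
  simp [sliceSnd]

@[simp] theorem sliceFst_tmul (φ : A →ₗ[ℂ] ℂ) (a b : A) : sliceFst φ (a ⊗ₜ b) = φ a • b := by
  simp [sliceFst]

/-- The map `T ⊗ ι` on `A ⊗ A ⊗ A`. -/
def leg12 (T : A ⊗[ℂ] A →ₗ[ℂ] A ⊗[ℂ] A) : (A ⊗[ℂ] A) ⊗[ℂ] A →ₗ[ℂ] (A ⊗[ℂ] A) ⊗[ℂ] A :=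
  T.rTensor A

/-- The map `ι ⊗ T` on `A ⊗ A ⊗ A`. -/
def leg23 (T : A ⊗[ℂ] A →ₗ[ℂ] A ⊗[ℂ] A) : (A ⊗[ℂ] A) ⊗[ℂ] A →ₗ[ℂ] (A ⊗[ℂ] A) ⊗[ℂ] A :=
  (TensorProduct.assoc ℂ A A A).symm.toLinearMap ∘ₗ T.lTensor A ∘ₗ
    (TensorProduct.assoc ℂ A A A).toLinearMap

/-- The map `T` acting on the first and the third factor of `A ⊗ A ⊗ A`. -/
def leg13 (T : A ⊗[ℂ] A →ₗ[ℂ] A ⊗[ℂ] A) : (A ⊗[ℂ] A) ⊗[ℂ] A →ₗ[ℂ] (A ⊗[ℂ] A) ⊗[ℂ] A :=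
  (TensorProduct.rightComm ℂ A A A).toLinearMap ∘ₗ T.rTensor A ∘ₗ
    (TensorProduct.rightComm ℂ A A A).toLinearMap

end Legs

section Tensor

variable {A : Type*} [NonUnitalRing A] [Module ℂ A] [IsScalarTower ℂ A A] [SMulCommClass ℂ A A]

theorem tensor_assoc_mul (x y : (A ⊗[ℂ] A) ⊗[ℂ] A) :
    TensorProduct.assoc ℂ A A A (x * y) =
      TensorProduct.assoc ℂ A A A x * TensorProduct.assoc ℂ A A A y := by
  induction x with
  | zero => simp
  | add x x' hx hx' => simp [add_mul, hx, hx']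
  | tmul p c =>
    induction p with
    | zero => simp
    | add p p' hp hp' => simp only [TensorProduct.add_tmul, add_mul, map_add, hp, hp']
    | tmul a b =>
      induction y with
      | zero => simp
      | add y y' hy hy' => simp only [mul_add, map_add, hy, hy']
      | tmul q c' =>
        induction q with
        | zero => simp
        | add p p' hp hp' => simp only [TensorProduct.add_tmul, mul_add, map_add, hp, hp']
        | tmul a' b' => simp

theorem tensor_assoc_symm_mul (x y : A ⊗[ℂ] (A ⊗[ℂ] A)) :
    (TensorProduct.assoc ℂ A A A).symm (x * y) =
      (TensorProduct.assoc ℂ A A A).symm x * (TensorProduct.assoc ℂ A A A).symm y := by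
  apply (TensorProduct.assoc ℂ A A A).injective
  simp [tensor_assoc_mul]

/-- The identification of `M(A ⊗ (A ⊗ A))` with `M((A ⊗ A) ⊗ A)`. -/
def Multiplier.reassoc : Multiplier (A ⊗[ℂ] (A ⊗[ℂ] A)) →ₗ[ℂ] Multiplier ((A ⊗[ℂ] A) ⊗[ℂ] A) :=
  Multiplier.conj (TensorProduct.assoc ℂ A A A).symm tensor_assoc_symm_mul

/-- The map `f ⊗ ι` from `A ⊗ A` to `M(A ⊗ A ⊗ A)`, for a linear map `f : A → M(A ⊗ A)`. -/
def Multiplier.tensorId (f : A →ₗ[ℂ] Multiplier (A ⊗[ℂ] A)) :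
    A ⊗[ℂ] A →ₗ[ℂ] Multiplier ((A ⊗[ℂ] A) ⊗[ℂ] A) :=
  TensorProduct.lift (Multiplier.tmul.compl₁₂ f Multiplier.of)

/-- The map `ι ⊗ f` from `A ⊗ A` to `M(A ⊗ A ⊗ A)`, for a linear map `f : A → M(A ⊗ A)`. -/
def Multiplier.idTensor (f : A →ₗ[ℂ] Multiplier (A ⊗[ℂ] A)) :
    A ⊗[ℂ] A →ₗ[ℂ] Multiplier ((A ⊗[ℂ] A) ⊗[ℂ] A) :=
  Multiplier.reassoc ∘ₗ TensorProduct.lift (Multiplier.tmul.compl₁₂ Multiplier.of f)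

/-- The multiplier `m ⊗ 1` of `A ⊗ A ⊗ A`. -/
def Multiplier.tensorOne (m : Multiplier (A ⊗[ℂ] A)) : Multiplier ((A ⊗[ℂ] A) ⊗[ℂ] A) :=
  Multiplier.tmul m 1

/-- The multiplier `1 ⊗ m` of `A ⊗ A ⊗ A`. -/
def Multiplier.oneTensor (m : Multiplier (A ⊗[ℂ] A)) : Multiplier ((A ⊗[ℂ] A) ⊗[ℂ] A) :=
  Multiplier.reassoc (Multiplier.tmul 1 m)

theorem sliceSnd_mul (φ : A →ₗ[ℂ] ℂ) (x : A ⊗[ℂ] A) (c : A) :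
    sliceSnd φ x * c = sliceSnd φ ((Multiplier.tmul (Multiplier.of c) 1).right x) := by
  induction x with
  | zero => simp
  | add x y hx hy => simp only [map_add, add_mul, hx, hy]
  | tmul a b => simp [smul_mul_assoc]

theorem mul_sliceSnd (φ : A →ₗ[ℂ] ℂ) (x : A ⊗[ℂ] A) (c : A) :
    c * sliceSnd φ x = sliceSnd φ ((Multiplier.tmul (Multiplier.of c) 1).left x) := by
  induction x with
  | zero => simp
  | add x y hx hy => simp only [map_add, mul_add, hx, hy]
  | tmul a b => simp [mul_smul_comm]

theorem sliceFst_mul (φ : A →ₗ[ℂ] ℂ) (x : A ⊗[ℂ] A) (c : A) :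
    sliceFst φ x * c = sliceFst φ ((Multiplier.tmul 1 (Multiplier.of c)).right x) := by
  induction x with
  | zero => simp
  | add x y hx hy => simp only [map_add, add_mul, hx, hy]
  | tmul a b => simp [smul_mul_assoc]

theorem mul_sliceFst (φ : A →ₗ[ℂ] ℂ) (x : A ⊗[ℂ] A) (c : A) :
    c * sliceFst φ x = sliceFst φ ((Multiplier.tmul 1 (Multiplier.of c)).left x) := by
  induction x with
  | zero => simp
  | add x y hx hy => simp only [map_add, mul_add, hx, hy]
  | tmul a b => simp [mul_smul_comm]

theorem eq_zero_of_lTensor_eq_zero {I : Type*} (g : I → A →ₗ[ℂ] A)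
    (hg : ∀ a, (∀ i, g i a = 0) → a = 0) (x : A ⊗[ℂ] A)
    (hx : ∀ i, (g i).lTensor A x = 0) : x = 0 := by
  let e := TensorProduct.equivFinsuppOfBasisLeft (N := A) (Module.Free.chooseBasis ℂ A)
  have key : ∀ i k (z : A ⊗[ℂ] A), e ((g i).lTensor A z) k = g i (e z k) := by
    intro i k z
    induction z with
    | zero => simp
    | add z z' hz hz' => simp only [map_add, Finsupp.add_apply, hz, hz']
    | tmul a b => simp [e]
  apply e.injective
  ext k
  rw [map_zero, Finsupp.zero_apply]
  apply hg
  intro i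
  rw [← key, hx, map_zero, Finsupp.zero_apply]

theorem eq_zero_of_rTensor_eq_zero {I : Type*} (g : I → A →ₗ[ℂ] A)
    (hg : ∀ a, (∀ i, g i a = 0) → a = 0) (x : A ⊗[ℂ] A)
    (hx : ∀ i, (g i).rTensor A x = 0) : x = 0 := by
  apply (TensorProduct.comm ℂ A A).injective
  rw [map_zero]
  apply eq_zero_of_lTensor_eq_zero g hg
  intro i
  have h := congrArg (TensorProduct.comm ℂ A A) (hx i)
  rw [map_zero] at h
  rw [← h]
  exact (LinearMap.congr_fun (LinearMap.comm_comp_rTensor_comp_comm_eq (g i)) _).symm.trans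
    (by simp)

/-- A tensor is zero if it is killed by right multiplication with all elements `a ⊗ b`. -/
theorem eq_zero_of_mul_tmul (hA : IsNondegenerateProduct A) (x : A ⊗[ℂ] A)
    (hx : ∀ a b : A, x * (a ⊗ₜ[ℂ] b) = 0) : x = 0 := by
  apply eq_zero_of_rTensor_eq_zero (fun a : A => LinearMap.mulRight ℂ a) (fun a h => hA.1 a h)
  intro a
  apply eq_zero_of_lTensor_eq_zero (fun b : A => LinearMap.mulRight ℂ b) (fun b h => hA.1 b h)
  intro b
  rw [← hx a b]
  generalize x = z
  induction z with
  | zero => simp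
  | add x y hx hy => simp only [map_add, add_mul, hx, hy]
  | tmul c d => simp

/-- A tensor is zero if it is killed by left multiplication with all elements `a ⊗ b`. -/
theorem eq_zero_of_tmul_mul (hA : IsNondegenerateProduct A) (x : A ⊗[ℂ] A)
    (hx : ∀ a b : A, (a ⊗ₜ[ℂ] b) * x = 0) : x = 0 := by
  apply eq_zero_of_rTensor_eq_zero (fun a : A => LinearMap.mulLeft ℂ a) (fun a h => hA.2 a h)
  intro a
  apply eq_zero_of_lTensor_eq_zero (fun b : A => LinearMap.mulLeft ℂ b) (fun b h => hA.2 b h)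
  intro b
  rw [← hx a b]
  generalize x = z
  induction z with
  | zero => simp
  | add x y hx hy => simp only [map_add, mul_add, hx, hy]
  | tmul c d => simp

/-- The product of `A ⊗ A` is non-degenerate if that of `A` is. -/
theorem IsNondegenerateProduct.tensor (hA : IsNondegenerateProduct A) :
    IsNondegenerateProduct (A ⊗[ℂ] A) :=
  ⟨fun x h => eq_zero_of_mul_tmul hA x fun a b => h (a ⊗ₜ b),
    fun x h => eq_zero_of_tmul_mul hA x fun a b => h (a ⊗ₜ b)⟩

theorem eq_of_of_eq (hA : IsNondegenerateProduct A) {x y : A ⊗[ℂ] A}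
    (h : Multiplier.of x = Multiplier.of y) : x = y := by
  rw [← sub_eq_zero]
  apply eq_zero_of_mul_tmul hA
  intro a b
  rw [sub_mul, sub_eq_zero]
  exact congrArg (fun m : Multiplier (A ⊗[ℂ] A) => m.left (a ⊗ₜ b)) h

end Tensor

section WeakMultiplierHopf

open Multiplier

/-- A weak multiplier Hopf algebra: a non-degenerate idempotent complex algebra `A` with a full
coproduct `Δ`, a counit `ε` and a canonical idempotent `E`. The maps `T₁`, `T₂`, `ε`, `E`, `G₁`
and `G₂` are uniquely determined by `Δ`. -/
structure WeakMultiplierHopfAlgebra (A : Type*) [NonUnitalRing A] [Module ℂ A]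
    [IsScalarTower ℂ A A] [SMulCommClass ℂ A A] where
  /-- The product of `A` is non-degenerate. -/
  nondegenerate : IsNondegenerateProduct A
  /-- The algebra is idempotent: `A² = A`. -/
  idempotent : Submodule.span ℂ {x : A | ∃ a b : A, x = a * b} = ⊤
  /-- The coproduct, a homomorphism from `A` to `M(A ⊗ A)`. -/
  Δ : A →ₙₐ[ℂ] Multiplier (A ⊗[ℂ] A)
  /-- The canonical map `T₁ (a ⊗ b) = Δ(a)(1 ⊗ b)`, with values in `A ⊗ A`. -/
  T₁ : A ⊗[ℂ] A →ₗ[ℂ] A ⊗[ℂ] A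
  of_T₁ : ∀ a b : A, of (T₁ (a ⊗ₜ b)) = Δ a * tmul 1 (of b)
  /-- The canonical map `T₂ (c ⊗ a) = (c ⊗ 1)Δ(a)`, with values in `A ⊗ A`. -/
  T₂ : A ⊗[ℂ] A →ₗ[ℂ] A ⊗[ℂ] A
  of_T₂ : ∀ c a : A, of (T₂ (c ⊗ₜ a)) = tmul (of c) 1 * Δ a
  /-- Coassociativity:
  `(c ⊗ 1 ⊗ 1)(Δ ⊗ ι)(Δ(a)(1 ⊗ b)) = (ι ⊗ Δ)((c ⊗ 1)Δ(a))(1 ⊗ 1 ⊗ b)`. -/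
  coassoc : leg12 T₂ ∘ₗ leg23 T₁ = leg23 T₁ ∘ₗ leg12 T₂
  /-- The left leg of `Δ` is all of `A`. -/
  full_left : ∀ V : Submodule ℂ A,
    (∀ a b : A, T₁ (a ⊗ₜ b) ∈ LinearMap.range (V.subtype.rTensor A)) → V = ⊤
  /-- The right leg of `Δ` is all of `A`. -/
  full_right : ∀ V : Submodule ℂ A,
    (∀ c a : A, T₂ (c ⊗ₜ a) ∈ LinearMap.range (V.subtype.lTensor A)) → V = ⊤
  /-- The counit. -/
  ε : A →ₗ[ℂ] ℂ
  counit_left : ∀ a b : A, sliceFst ε (T₁ (a ⊗ₜ b)) = a * b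
  counit_right : ∀ c a : A, sliceSnd ε (T₂ (c ⊗ₜ a)) = c * a
  /-- The canonical idempotent. -/
  E : Multiplier (A ⊗[ℂ] A)
  E_mul_E : E * E = E
  /-- `T₁(A ⊗ A) = E(A ⊗ A)`. -/
  range_T₁ : LinearMap.range T₁ = LinearMap.range E.left
  /-- `T₂(A ⊗ A) = (A ⊗ A)E`. -/
  range_T₂ : LinearMap.range T₂ = LinearMap.range E.right
  /-- `(E ⊗ 1)(1 ⊗ E) = (1 ⊗ E)(E ⊗ 1)`. -/
  E_comm : tensorOne E * oneTensor E = oneTensor E * tensorOne E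
  /-- `(Δ ⊗ ι)E = (E ⊗ 1)(1 ⊗ E)`, where `Δ ⊗ ι` is extended so that `(Δ ⊗ ι)1 = E ⊗ 1`. -/
  tensorId_E : IsExtensionValue (tensorId (Δ : A →ₗ[ℂ] Multiplier (A ⊗[ℂ] A)))
    (tensorOne E) E (tensorOne E * oneTensor E)
  /-- `(ι ⊗ Δ)E = (E ⊗ 1)(1 ⊗ E)`, where `ι ⊗ Δ` is extended so that `(ι ⊗ Δ)1 = 1 ⊗ E`. -/
  idTensor_E : IsExtensionValue (idTensor (Δ : A →ₗ[ℂ] Multiplier (A ⊗[ℂ] A)))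
    (oneTensor E) E (tensorOne E * oneTensor E)
  /-- The map `G₁`, with `(G₁ ⊗ ι)(Δ₁₃(a)(1 ⊗ b ⊗ c)) = Δ₁₃(a)(1 ⊗ E)(1 ⊗ b ⊗ c)`. -/
  G₁ : A ⊗[ℂ] A →ₗ[ℂ] A ⊗[ℂ] A
  G₁_spec : leg12 G₁ ∘ₗ leg13 T₁ = leg13 T₁ ∘ₗ leg23 E.left
  /-- The map `G₂`, with `(ι ⊗ G₂)((a ⊗ b ⊗ 1)Δ₁₃(c)) = (a ⊗ b ⊗ 1)(E ⊗ 1)Δ₁₃(c)`. -/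
  G₂ : A ⊗[ℂ] A →ₗ[ℂ] A ⊗[ℂ] A
  G₂_spec : leg23 G₂ ∘ₗ leg13 T₂ = leg13 T₂ ∘ₗ leg12 E.right
  /-- `Ker T₁ = (1 - G₁)(A ⊗ A)`. -/
  ker_T₁ : LinearMap.ker T₁ = LinearMap.range (LinearMap.id - G₁)
  /-- `Ker T₂ = (1 - G₂)(A ⊗ A)`. -/
  ker_T₂ : LinearMap.ker T₂ = LinearMap.range (LinearMap.id - G₂)

variable {A : Type*} [NonUnitalRing A] [Module ℂ A] [IsScalarTower ℂ A A] [SMulCommClass ℂ A A]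

/-- The linear map `S : A → A` is the antipode. Let `R₁` and `R₂` be the generalized inverses of
`T₁` and `T₂` given by the projections `E ·`, `G₁` and `· E`, `G₂`. The antipode is defined by
`S(a)b = (ε ⊗ ι)R₁(a ⊗ b)` and `bS(a) = (ι ⊗ ε)R₂(b ⊗ a)`. -/
def WeakMultiplierHopfAlgebra.IsAntipode (H : WeakMultiplierHopfAlgebra A) (S : A →ₗ[ℂ] A) :
    Prop :=
  ∃ R₁ R₂ : A ⊗[ℂ] A →ₗ[ℂ] A ⊗[ℂ] A,
    (H.T₁ ∘ₗ R₁ = H.E.left ∧ R₁ ∘ₗ H.T₁ = H.G₁ ∧ R₁ ∘ₗ H.T₁ ∘ₗ R₁ = R₁) ∧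
    (H.T₂ ∘ₗ R₂ = H.E.right ∧ R₂ ∘ₗ H.T₂ = H.G₂ ∧ R₂ ∘ₗ H.T₂ ∘ₗ R₂ = R₂) ∧
    (∀ a b : A, S a * b = sliceFst H.ε (R₁ (a ⊗ₜ b))) ∧
    (∀ a b : A, b * S a = sliceSnd H.ε (R₂ (b ⊗ₜ a)))

/-- A regular weak multiplier Hopf algebra: the coproduct is regular and the antipode is a
bijective map from `A` to itself. -/
structure RegularWeakMultiplierHopfAlgebra (A : Type*) [NonUnitalRing A] [Module ℂ A]
    [IsScalarTower ℂ A A] [SMulCommClass ℂ A A] extends WeakMultiplierHopfAlgebra A where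
  /-- The canonical map `T₃ (a ⊗ b) = (1 ⊗ b)Δ(a)`, with values in `A ⊗ A`. -/
  T₃ : A ⊗[ℂ] A →ₗ[ℂ] A ⊗[ℂ] A
  of_T₃ : ∀ a b : A, of (T₃ (a ⊗ₜ b)) = tmul 1 (of b) * Δ a
  /-- The canonical map `T₄ (c ⊗ a) = Δ(a)(c ⊗ 1)`, with values in `A ⊗ A`. -/
  T₄ : A ⊗[ℂ] A →ₗ[ℂ] A ⊗[ℂ] A
  of_T₄ : ∀ c a : A, of (T₄ (c ⊗ₜ a)) = Δ a * tmul (of c) 1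
  /-- The antipode. -/
  S : A ≃ₗ[ℂ] A
  isAntipode : toWeakMultiplierHopfAlgebra.IsAntipode S

namespace RegularWeakMultiplierHopfAlgebra

variable (H : RegularWeakMultiplierHopfAlgebra A)

/-- The multiplier `x = (ι ⊗ ω)Δ(a)` of `A`, given by `xb = (ι ⊗ ω)(Δ(a)(b ⊗ 1))` and
`bx = (ι ⊗ ω)((b ⊗ 1)Δ(a))`. -/
def sndSliceΔ (ω : A →ₗ[ℂ] ℂ) (a : A) : Multiplier A :=
  Multiplier.mk (sliceSnd ω ∘ₗ H.T₄ ∘ₗ (TensorProduct.mk ℂ A A).flip a)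
    (sliceSnd ω ∘ₗ H.T₂ ∘ₗ (TensorProduct.mk ℂ A A).flip a) (by
      intro b c
      change sliceSnd ω (H.T₂ (b ⊗ₜ a)) * c = b * sliceSnd ω (H.T₄ (c ⊗ₜ a))
      rw [sliceSnd_mul, mul_sliceSnd]
      congr 1
      apply eq_of_of_eq H.nondegenerate
      rw [of_right H.nondegenerate.tensor, of_left H.nondegenerate.tensor, H.of_T₂, H.of_T₄, mul_assoc])

/-- The multiplier `x = (ω ⊗ ι)Δ(a)` of `A`, given by `xb = (ω ⊗ ι)(Δ(a)(1 ⊗ b))` and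
`bx = (ω ⊗ ι)((1 ⊗ b)Δ(a))`. -/
def fstSliceΔ (ω : A →ₗ[ℂ] ℂ) (a : A) : Multiplier A :=
  Multiplier.mk (sliceFst ω ∘ₗ H.T₁ ∘ₗ TensorProduct.mk ℂ A A a)
    (sliceFst ω ∘ₗ H.T₃ ∘ₗ TensorProduct.mk ℂ A A a) (by
      intro b c
      change sliceFst ω (H.T₃ (a ⊗ₜ b)) * c = b * sliceFst ω (H.T₁ (a ⊗ₜ c))
      rw [sliceFst_mul, mul_sliceFst]
      congr 1
      apply eq_of_of_eq H.nondegenerate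
      rw [of_right H.nondegenerate.tensor, of_left H.nondegenerate.tensor, H.of_T₃, H.of_T₁, mul_assoc])

/-- The image `ε_t(A)` of the target map. The multiplier `x = ε_t(a) = ∑ a₍₁₎ S(a₍₂₎)` is
determined by `cx = ∑ c a₍₁₎ S(a₍₂₎)` for all `c`, where `c` covers `a₍₁₎`. -/
def targetImage : Set (Multiplier A) :=
  {x | ∃ a : A, ∀ c : A,
    x.right c = LinearMap.mul' ℂ A ((H.S : A →ₗ[ℂ] A).lTensor A (H.T₂ (c ⊗ₜ a)))}

/-- The image `ε_s(A)` of the source map. The multiplier `x = ε_s(a) = ∑ S(a₍₁₎) a₍₂₎` is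
determined by `xb = ∑ S(a₍₁₎) a₍₂₎ b` for all `b`, where `b` covers `a₍₂₎`. -/
def sourceImage : Set (Multiplier A) :=
  {x | ∃ a : A, ∀ b : A,
    x.left b = LinearMap.mul' ℂ A ((H.S : A →ₗ[ℂ] A).rTensor A (H.T₁ (a ⊗ₜ b)))}

/-- The multiplier algebra `A_t = M(ε_t(A))`, as a subset of `M(A)`. -/
def targetMultiplier : Set (Multiplier A) :=
  {x | ∀ y ∈ H.targetImage, x * y ∈ H.targetImage ∧ y * x ∈ H.targetImage}

/-- The multiplier algebra `A_s = M(ε_s(A))`, as a subset of `M(A)`. -/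
def sourceMultiplier : Set (Multiplier A) :=
  {x | ∀ y ∈ H.sourceImage, x * y ∈ H.sourceImage ∧ y * x ∈ H.sourceImage}

/-- `φ` is left invariant: `(ι ⊗ φ)Δ(a) ∈ A_t` for all `a`. -/
def IsLeftInvariant (φ : A →ₗ[ℂ] ℂ) : Prop :=
  ∀ a : A, H.sndSliceΔ φ a ∈ H.targetMultiplier

/-- `ψ` is right invariant: `(ψ ⊗ ι)Δ(a) ∈ A_s` for all `a`. -/
def IsRightInvariant (ψ : A →ₗ[ℂ] ℂ) : Prop :=
  ∀ a : A, H.fstSliceΔ ψ a ∈ H.sourceMultiplier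

end RegularWeakMultiplierHopfAlgebra

end WeakMultiplierHopf

end

/-!
Let `φ` be left invariant. The multipliers `x = (ι ⊗ φ)Δ(p)` lie in `A_t`, and every `x` in `A_t`
satisfies `Δ(ax) = Δ(a)(x ⊗ 1)` (`Δ_mul_of_mem`, `Δ_right_eq`). By the pentagon identity
`pentagon_T₂` this determines `(ι ⊗ φ)T₂` on the right leg of `Δ`: the result is `(c ⊗ d)E(x ⊗ 1)`,
which is also what the definition of the projection `G₂` gives for `(ι ⊗ φ)G₂`. As the coproduct is
full, `(ι ⊗ φ)T₂ = (ι ⊗ φ)G₂` (`sliceSnd_T₂_eq_sliceSnd_G₂`). Both maps are applied to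
`R₂(c ⊗ a)(1 ⊗ b)`, where `R₂` is the generalized inverse of `T₂` that defines the antipode, so that
`R₂(c ⊗ a) = ∑ cS(a₍₁₎) ⊗ a₍₂₎` (`lTensor_mulRight_R₂`). The first gives
`(ι ⊗ φ)((c ⊗ a)EΔ(b)) = c(ι ⊗ φ)((1 ⊗ a)Δ(b))`. The second gives `cS((ι ⊗ φ)(Δ(a)(1 ⊗ b)))`,
because `G₂R₂ = R₂` and `G₂` commutes with right multiplication in the second leg (`G₂_tmul_mul`).

Conversely, the formula and coassociativity give `(ι ⊗ φ)Δ(ab) = ε_t((ι ⊗ φ)(Δ(a)(1 ⊗ b)))`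
(`sndSliceΔ_mul`). As `A² = A`, all `(ι ⊗ φ)Δ(a)` lie in `ε_t(A)`, which is contained in `A_t`
because it is closed under products. Together with the first half this also shows that
`(ι ⊗ φ)Δ(a)` lies in `ε_t(A)` whenever `φ` is left invariant.

Two inputs need work. The description of the generalized inverses by the antipode holds because
`R₁` commutes with the left coaction (`leg12_T₂_leg23_R₁`), which follows from coassociativity and
the same property of the projections `E ·` and `G₁`. That `G₂` is a right module map rests on
`E(A ⊗ A) ⊆ Δ(A)(A ⊗ 1)`, the mirror image of `(A ⊗ A)E ⊆ (1 ⊗ A)Δ(A)`. The latter follows from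
`∑ (1 ⊗ pu₍₁₎)Δ(S(u₍₂₎)) = (S(u) ⊗ p)E` (`T₃_comm_lTensor_S_T₂`) and the surjectivity of `S`.

Mirror images, among them the whole theory of right invariant functionals, are obtained from the
opposite algebra with the opposite coproduct. It is constructed on any algebra `B` with a linear
anti-isomorphism `e` from `A` to `B`; at the end `B` is `Aᵐᵒᵖ`.
-/

noncomputable section

open LinearMap (mulLeft mulRight mul')

/-! ### Cancellation in tensor products -/

section Cancellation

variable {M N W : Type*} [AddCommGroup M] [Module ℂ M] [AddCommGroup N] [Module ℂ N]
  [AddCommGroup W] [Module ℂ W]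

/-- A jointly injective family of linear maps stays jointly injective after tensoring. -/
theorem eq_of_lTensor_eq {I : Type*} (g : I → N →ₗ[ℂ] W)
    (hg : ∀ n, (∀ i, g i n = 0) → n = 0) {x y : M ⊗[ℂ] N}
    (h : ∀ i, (g i).lTensor M x = (g i).lTensor M y) : x = y := by
  classical
  let ℬ := Module.Free.chooseBasis ℂ M
  let e := TensorProduct.equivFinsuppOfBasisLeft (N := N) ℬ
  let e' := TensorProduct.equivFinsuppOfBasisLeft (N := W) ℬ
  have key : ∀ i k (z : M ⊗[ℂ] N), e' ((g i).lTensor M z) k = g i (e z k) := by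
    intro i k z
    induction z with
    | zero => simp
    | add z z' hz hz' => simp only [map_add, Finsupp.add_apply, hz, hz']
    | tmul a b => simp [e, e']
  rw [← sub_eq_zero]
  apply e.injective
  ext k
  rw [map_zero, Finsupp.zero_apply]
  apply hg
  intro i
  rw [← key, map_sub, h, sub_self, map_zero, Finsupp.zero_apply]

theorem eq_of_rTensor_eq {I : Type*} (g : I → N →ₗ[ℂ] W)
    (hg : ∀ n, (∀ i, g i n = 0) → n = 0) {x y : N ⊗[ℂ] M}
    (h : ∀ i, (g i).rTensor M x = (g i).rTensor M y) : x = y := by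
  apply (TensorProduct.comm ℂ N M).injective
  apply eq_of_lTensor_eq g hg
  intro i
  have key : ∀ z : N ⊗[ℂ] M, (g i).lTensor M (TensorProduct.comm ℂ N M z) =
      TensorProduct.comm ℂ W M ((g i).rTensor M z) := fun z => by
    induction z with
    | zero => simp
    | add z z' hz hz' => simp only [map_add, hz, hz']
    | tmul a b => simp
  rw [key, key, h]

/-- If all slices of the tensor `z` along its second factor are killed by `D`, so is `z` by
`D ⊗ ι`. -/
theorem rTensor_eq_zero_of_slices (D : N →ₗ[ℂ] W) (z : N ⊗[ℂ] M)
    (h : ∀ ω : M →ₗ[ℂ] ℂ, D (TensorProduct.rid ℂ N (ω.lTensor N z)) = 0) :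
    D.rTensor M z = 0 := by
  classical
  let ℬ := Module.Free.chooseBasis ℂ M
  let e := TensorProduct.equivFinsuppOfBasisRight (M := W) ℬ
  apply e.injective
  ext k
  rw [map_zero, Finsupp.zero_apply, ← h (ℬ.coord k)]
  generalize z = z
  induction z with
  | zero => simp
  | add z z' hz hz' => simp only [map_add, Finsupp.add_apply, hz, hz']
  | tmul a b => simp [e]

theorem mem_range_ker_subtype_rTensor {D : N →ₗ[ℂ] W} {z : N ⊗[ℂ] M}
    (h : D.rTensor M z = 0) :
    z ∈ LinearMap.range ((LinearMap.ker D).subtype.rTensor M) :=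
  (Module.Flat.rTensor_exact M (LinearMap.exact_subtype_ker_map D) z).1 h

theorem mem_range_ker_subtype_lTensor {D : N →ₗ[ℂ] W} {z : M ⊗[ℂ] N}
    (h : D.lTensor M z = 0) :
    z ∈ LinearMap.range ((LinearMap.ker D).subtype.lTensor M) :=
  (Module.Flat.lTensor_exact M (LinearMap.exact_subtype_ker_map D) z).1 h

end Cancellation

/-! ### Non-degenerate algebras and their multipliers -/

section Nondegenerate

variable {A : Type*} [NonUnitalRing A] [Module ℂ A] [IsScalarTower ℂ A A] [SMulCommClass ℂ A A]
variable {B : Type*} [NonUnitalRing B] [Module ℂ B] [IsScalarTower ℂ B B] [SMulCommClass ℂ B B]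
variable {M : Type*} [AddCommGroup M] [Module ℂ M]

namespace IsNondegenerateProduct

theorem eq_of_rTensor_mulLeft (hA : IsNondegenerateProduct A) {x y : A ⊗[ℂ] M}
    (h : ∀ c : A, (mulLeft ℂ c).rTensor M x = (mulLeft ℂ c).rTensor M y) : x = y :=
  eq_of_rTensor_eq (fun c : A => mulLeft ℂ c) (fun a ha => hA.2 a ha) h

theorem eq_of_rTensor_mulRight (hA : IsNondegenerateProduct A) {x y : A ⊗[ℂ] M}
    (h : ∀ c : A, (mulRight ℂ c).rTensor M x = (mulRight ℂ c).rTensor M y) : x = y :=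
  eq_of_rTensor_eq (fun c : A => mulRight ℂ c) (fun a ha => hA.1 a ha) h

theorem eq_of_lTensor_mulLeft (hA : IsNondegenerateProduct A) {x y : M ⊗[ℂ] A}
    (h : ∀ c : A, (mulLeft ℂ c).lTensor M x = (mulLeft ℂ c).lTensor M y) : x = y :=
  eq_of_lTensor_eq (fun c : A => mulLeft ℂ c) (fun a ha => hA.2 a ha) h

theorem eq_of_lTensor_mulRight (hA : IsNondegenerateProduct A) {x y : M ⊗[ℂ] A}
    (h : ∀ c : A, (mulRight ℂ c).lTensor M x = (mulRight ℂ c).lTensor M y) : x = y :=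
  eq_of_lTensor_eq (fun c : A => mulRight ℂ c) (fun a ha => hA.1 a ha) h

theorem tmul (hA : IsNondegenerateProduct A) (hB : IsNondegenerateProduct B) :
    IsNondegenerateProduct (A ⊗[ℂ] B) := by
  constructor
  · intro x h
    refine hA.eq_of_rTensor_mulRight fun a => hB.eq_of_lTensor_mulRight fun b => ?_
    rw [map_zero, map_zero, ← h (a ⊗ₜ b)]
    generalize x = x
    induction x with
    | zero => simp
    | add x x' hx hx' => simp only [map_add, add_mul, hx, hx']
    | tmul c d => simp
  · intro x h
    refine hA.eq_of_rTensor_mulLeft fun a => hB.eq_of_lTensor_mulLeft fun b => ?_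
    rw [map_zero, map_zero, ← h (a ⊗ₜ b)]
    generalize x = x
    induction x with
    | zero => simp
    | add x x' hx hx' => simp only [map_add, mul_add, hx, hx']
    | tmul c d => simp

end IsNondegenerateProduct

namespace Multiplier

theorem of_injective (hA : IsNondegenerateProduct A) {x y : A} (h : of x = of y) : x = y := by
  rw [← sub_eq_zero]
  apply hA.1
  intro c
  rw [sub_mul, sub_eq_zero]
  exact congrArg (fun m : Multiplier A => m.left c) h

/-- A multiplier is determined by its left multiplication. -/
theorem ext_left (hA : IsNondegenerateProduct A) {m n : Multiplier A} (h : m.left = n.left) :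
    m = n := by
  refine ext' h (LinearMap.ext fun a => ?_)
  rw [← sub_eq_zero]
  apply hA.1
  intro c
  rw [sub_mul, sub_eq_zero, right_mul_eq, right_mul_eq, h]

/-- A multiplier is determined by its right multiplication. -/
theorem ext_right (hA : IsNondegenerateProduct A) {m n : Multiplier A} (h : m.right = n.right) :
    m = n := by
  refine ext' (LinearMap.ext fun a => ?_) h
  rw [← sub_eq_zero]
  apply hA.2
  intro c
  rw [mul_sub, sub_eq_zero, ← right_mul_eq, ← right_mul_eq, h]

theorem tmul_mul_tmul (m m' : Multiplier A) (n n' : Multiplier B) :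
    tmul m n * tmul m' n' = tmul (m * m') (n * n') := by
  refine ext' ?_ ?_
  · ext a b
    simp
  · ext a b
    simp

theorem tmul_of_of (a : A) (b : B) : tmul (of a) (of b) = of (a ⊗ₜ[ℂ] b) := by
  refine ext' ?_ ?_
  · ext c d
    simp
  · ext c d
    simp

theorem left_tensorOne (m : Multiplier (A ⊗[ℂ] A)) : (tensorOne m).left = leg12 m.left := rfl

theorem left_oneTensor (m : Multiplier (A ⊗[ℂ] A)) : (oneTensor m).left = leg23 m.left := rfl

theorem reassoc_mul (m n : Multiplier (A ⊗[ℂ] (A ⊗[ℂ] A))) :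
    reassoc (m * n) = reassoc m * reassoc n := by
  refine ext' (LinearMap.ext fun x => ?_) (LinearMap.ext fun x => ?_)
  · simp [reassoc]
  · simp [reassoc]

theorem reassoc_of (x : A ⊗[ℂ] (A ⊗[ℂ] A)) :
    reassoc (of x) = of ((TensorProduct.assoc ℂ A A A).symm x) := by
  refine ext' (LinearMap.ext fun y => ?_) (LinearMap.ext fun y => ?_)
  · simp [reassoc, tensor_assoc_symm_mul]
  · simp [reassoc, tensor_assoc_symm_mul]

theorem reassoc_tmul_tmul (l m n : Multiplier A) :
    reassoc (tmul l (tmul m n)) = tmul (tmul l m) n := by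
  refine ext' ?_ ?_
  · ext a b c
    simp [reassoc]
  · ext a b c
    simp [reassoc]

theorem tmul_one_one : tmul (1 : Multiplier A) (1 : Multiplier B) = 1 := by
  refine ext' ?_ ?_
  · ext a b
    simp
  · ext a b
    simp

theorem tensorId_tmul (f : A →ₗ[ℂ] Multiplier (A ⊗[ℂ] A)) (a b : A) :
    tensorId f (a ⊗ₜ b) = tmul (f a) (of b) := by
  simp [tensorId]

theorem idTensor_tmul (f : A →ₗ[ℂ] Multiplier (A ⊗[ℂ] A)) (a b : A) :
    idTensor f (a ⊗ₜ b) = reassoc (tmul (of a) (f b)) := by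
  simp [idTensor]

end Multiplier

end Nondegenerate

section Slices

variable {A : Type*} [NonUnitalRing A] [Module ℂ A] [IsScalarTower ℂ A A] [SMulCommClass ℂ A A]

theorem sliceSnd_rTensor (φ : A →ₗ[ℂ] ℂ) (f : A →ₗ[ℂ] A) (z : A ⊗[ℂ] A) :
    sliceSnd φ (f.rTensor A z) = f (sliceSnd φ z) := by
  induction z with
  | zero => simp
  | add x y hx hy => simp only [map_add, hx, hy]
  | tmul a b => simp

variable (T : A ⊗[ℂ] A →ₗ[ℂ] A ⊗[ℂ] A)

theorem leg12_tmul (z : A ⊗[ℂ] A) (c : A) : leg12 T (z ⊗ₜ c) = T z ⊗ₜ c := rfl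

theorem leg23_tmul (a b c : A) : leg23 T (a ⊗ₜ b ⊗ₜ c) =
    (TensorProduct.assoc ℂ A A A).symm (a ⊗ₜ T (b ⊗ₜ c)) := rfl

theorem leg13_tmul (a b c : A) : leg13 T (a ⊗ₜ b ⊗ₜ c) =
    TensorProduct.rightComm ℂ A A A (T (a ⊗ₜ c) ⊗ₜ b) := rfl

end Slices

/-! ### Identities for the canonical maps -/

section Canonical

open Multiplier

variable {A : Type*} [NonUnitalRing A] [Module ℂ A] [IsScalarTower ℂ A A] [SMulCommClass ℂ A A]

theorem Multiplier.eq_of_mul_one_tmul (hA : IsNondegenerateProduct A)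
    {m n : Multiplier (A ⊗[ℂ] A)} (h : ∀ b : A, m * tmul 1 (of b) = n * tmul 1 (of b)) :
    m = n := by
  refine ext_right hA.tensor (LinearMap.ext fun z => hA.eq_of_lTensor_mulRight fun b => ?_)
  exact congrArg (fun k : Multiplier (A ⊗[ℂ] A) => k.right z) (h b)

theorem Multiplier.eq_of_tmul_one_mul (hA : IsNondegenerateProduct A)
    {m n : Multiplier (A ⊗[ℂ] A)} (h : ∀ c : A, tmul (of c) 1 * m = tmul (of c) 1 * n) :
    m = n := by
  refine ext_left hA.tensor (LinearMap.ext fun z => hA.eq_of_rTensor_mulLeft fun b => ?_)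
  exact congrArg (fun k : Multiplier (A ⊗[ℂ] A) => k.left z) (h b)

namespace WeakMultiplierHopfAlgebra

variable (H : WeakMultiplierHopfAlgebra A)

theorem nondegenerate₃ (H : WeakMultiplierHopfAlgebra A) :
    IsNondegenerateProduct ((A ⊗[ℂ] A) ⊗[ℂ] A) :=
  H.nondegenerate.tensor.tmul H.nondegenerate

theorem E_left_E_left (z : A ⊗[ℂ] A) : H.E.left (H.E.left z) = H.E.left z :=
  congrArg (fun m : Multiplier (A ⊗[ℂ] A) => m.left z) H.E_mul_E

theorem E_right_E_right (z : A ⊗[ℂ] A) : H.E.right (H.E.right z) = H.E.right z :=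
  congrArg (fun m : Multiplier (A ⊗[ℂ] A) => m.right z) H.E_mul_E

theorem E_left_T₁ (z : A ⊗[ℂ] A) : H.E.left (H.T₁ z) = H.T₁ z := by
  have h : H.T₁ z ∈ LinearMap.range H.E.left := H.range_T₁ ▸ LinearMap.mem_range_self H.T₁ z
  obtain ⟨w, hw⟩ := h
  rw [← hw, E_left_E_left]

theorem E_right_T₂ (z : A ⊗[ℂ] A) : H.E.right (H.T₂ z) = H.T₂ z := by
  have h : H.T₂ z ∈ LinearMap.range H.E.right := H.range_T₂ ▸ LinearMap.mem_range_self H.T₂ z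
  obtain ⟨w, hw⟩ := h
  rw [← hw, E_right_E_right]

theorem exists_T₁_eq_E_left (z : A ⊗[ℂ] A) : ∃ w, H.T₁ w = H.E.left z := by
  have h : H.E.left z ∈ LinearMap.range H.T₁ := H.range_T₁ ▸ LinearMap.mem_range_self _ z
  exact h

theorem exists_T₂_eq_E_right (z : A ⊗[ℂ] A) : ∃ w, H.T₂ w = H.E.right z := by
  have h : H.E.right z ∈ LinearMap.range H.T₂ := H.range_T₂ ▸ LinearMap.mem_range_self _ z
  exact h

theorem E_mul_Δ (a : A) : H.E * H.Δ a = H.Δ a := by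
  refine eq_of_mul_one_tmul H.nondegenerate fun b => ?_
  rw [mul_assoc, ← H.of_T₁, ← of_left H.nondegenerate.tensor, E_left_T₁]

theorem Δ_mul_E (a : A) : H.Δ a * H.E = H.Δ a := by
  refine eq_of_tmul_one_mul H.nondegenerate fun b => ?_
  rw [← mul_assoc, ← H.of_T₂, ← of_right H.nondegenerate.tensor, E_right_T₂]

theorem E_left_Δ_left (a : A) (z : A ⊗[ℂ] A) :
    H.E.left ((H.Δ a).left z) = (H.Δ a).left z :=
  congrArg (fun m : Multiplier (A ⊗[ℂ] A) => m.left z) (H.E_mul_Δ a)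

theorem Δ_right_E_right (a : A) (z : A ⊗[ℂ] A) :
    (H.Δ a).right (H.E.right z) = (H.Δ a).right z :=
  congrArg (fun m : Multiplier (A ⊗[ℂ] A) => m.right z) (H.E_mul_Δ a)

/-- Since `Δ(A)(A ⊗ A)` is `E(A ⊗ A)`, right factors `Δ(a)` can be cancelled up to `E`. -/
theorem mul_E_eq_of_mul_Δ_eq {m n : Multiplier (A ⊗[ℂ] A)}
    (h : ∀ a, m * H.Δ a = n * H.Δ a) : m * H.E = n * H.E := by
  have key : ∀ w, m * of (H.T₁ w) = n * of (H.T₁ w) := fun w => by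
    induction w with
    | zero => simp
    | add x y hx hy => simp only [map_add, mul_add, hx, hy]
    | tmul c a => rw [H.of_T₁, ← mul_assoc, h, mul_assoc]
  refine ext_right H.nondegenerate.tensor (LinearMap.ext fun z => ?_)
  rw [← sub_eq_zero]
  apply H.nondegenerate.tensor.1
  intro x
  rw [sub_mul, sub_eq_zero]
  obtain ⟨w, hw⟩ := H.exists_T₁_eq_E_left x
  have := key w
  rw [hw, of_left H.nondegenerate.tensor, ← mul_assoc, ← mul_assoc] at this
  exact congrArg (fun m : Multiplier (A ⊗[ℂ] A) => m.right z) this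

/-- `(c ⊗ 1)(Δ(a)(1 ⊗ b)) = ((c ⊗ 1)Δ(a))(1 ⊗ b)`. -/
theorem rTensor_mulLeft_T₁ (a b c : A) :
    (mulLeft ℂ c).rTensor A (H.T₁ (a ⊗ₜ b)) = (mulRight ℂ b).lTensor A (H.T₂ (c ⊗ₜ a)) := by
  apply of_injective H.nondegenerate.tensor
  change of ((tmul (of c) 1).left _) = of ((tmul 1 (of b)).right _)
  rw [of_left H.nondegenerate.tensor, of_right H.nondegenerate.tensor, H.of_T₁, H.of_T₂,
    mul_assoc]

theorem lTensor_mulLeft_T₂ (c d a : A) :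
    (mulLeft ℂ d).lTensor A (H.T₂ (c ⊗ₜ a)) = (H.Δ a).right (c ⊗ₜ d) := by
  apply of_injective H.nondegenerate.tensor
  change of ((tmul 1 (of d)).left _) = _
  rw [of_left H.nondegenerate.tensor, of_right H.nondegenerate.tensor, H.of_T₂, ← mul_assoc,
    tmul_mul_tmul, one_mul, mul_one, tmul_of_of]

theorem T₂_mul (c a b : A) : H.T₂ (c ⊗ₜ (a * b)) = (H.Δ b).right (H.T₂ (c ⊗ₜ a)) := by
  apply of_injective H.nondegenerate.tensor
  rw [of_right H.nondegenerate.tensor, H.of_T₂, H.of_T₂, map_mul, mul_assoc]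

/-! ### Identities in three legs -/

/-- The map `c ⊗ a ⊗ b ↦ (c ⊗ 1 ⊗ 1)(Δ ⊗ ι)(a ⊗ b)` commutes with left multiplication by `1 ⊗ E`.
This is the left half of `(Δ ⊗ ι)E = (E ⊗ 1)(1 ⊗ E)`; the factor `E ⊗ 1` is absorbed by `Δ`. -/
theorem leg12_T₂_leg23_E_left (x : (A ⊗[ℂ] A) ⊗[ℂ] A) :
    leg12 H.T₂ (leg23 H.E.left x) = leg23 H.E.left (leg12 H.T₂ x) := by
  refine LinearMap.congr_fun (f := leg12 H.T₂ ∘ₗ leg23 H.E.left)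
    (g := leg23 H.E.left ∘ₗ leg12 H.T₂) (TensorProduct.ext_threefold fun c a b => ?_) x
  let f := tensorId (H.Δ : A →ₗ[ℂ] Multiplier (A ⊗[ℂ] A))
  have key : ∀ z, of (leg12 H.T₂ ((TensorProduct.assoc ℂ A A A).symm (c ⊗ₜ z))) =
      tensorOne (tmul (of c) 1) * f z := fun z => by
    induction z with
    | zero => simp
    | add x y hx hy => simp only [TensorProduct.tmul_add, map_add, mul_add, hx, hy]
    | tmul a b =>
      simp only [f]
      rw [TensorProduct.assoc_symm_tmul, leg12_tmul, ← tmul_of_of, H.of_T₂, tensorId_tmul,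
        tensorOne, tmul_mul_tmul, one_mul]
      rfl
  have hC : tensorOne (tmul (of c) 1) * oneTensor H.E =
      oneTensor H.E * tensorOne (tmul (of c) 1) := by
    have : tensorOne (tmul (of c) (1 : Multiplier A)) = reassoc (tmul (of c) 1) := by
      rw [← tmul_one_one, reassoc_tmul_tmul]
      rfl
    rw [this, oneTensor, ← reassoc_mul, ← reassoc_mul, tmul_mul_tmul, tmul_mul_tmul]
    simp only [one_mul, mul_one]
  have hE : tensorOne H.E * f (a ⊗ₜ b) = f (a ⊗ₜ b) := by
    simp only [f]
    rw [tensorId_tmul, tensorOne, tmul_mul_tmul, one_mul]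
    exact congrArg (fun m => tmul m (of b)) (H.E_mul_Δ a)
  apply of_injective H.nondegenerate₃
  change of (leg12 H.T₂ ((TensorProduct.assoc ℂ A A A).symm (c ⊗ₜ H.E.left (a ⊗ₜ b)))) =
    of ((oneTensor H.E).left (leg12 H.T₂
      ((TensorProduct.assoc ℂ A A A).symm (c ⊗ₜ (a ⊗ₜ b)))))
  rw [of_left H.nondegenerate₃, key, key, ← H.tensorId_E.1, H.E_comm, mul_assoc, hE, ← mul_assoc,
    hC, mul_assoc]

/-- The left half of `(ι ⊗ Δ)E = (E ⊗ 1)(1 ⊗ E)`; the factor `1 ⊗ E` is absorbed by `Δ`. -/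
theorem leg12_E_left_leg23_T₁ (x : (A ⊗[ℂ] A) ⊗[ℂ] A) :
    leg12 H.E.left (leg23 H.T₁ x) = leg23 H.T₁ (leg12 H.E.left x) := by
  refine LinearMap.congr_fun (f := leg12 H.E.left ∘ₗ leg23 H.T₁)
    (g := leg23 H.T₁ ∘ₗ leg12 H.E.left) (TensorProduct.ext_threefold fun b a s => ?_) x
  let f := idTensor (H.Δ : A →ₗ[ℂ] Multiplier (A ⊗[ℂ] A))
  have key : ∀ z, of (leg23 H.T₁ (z ⊗ₜ s)) = f z * oneTensor (tmul 1 (of s)) := fun z => by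
    induction z with
    | zero => simp
    | add x y hx hy => simp only [TensorProduct.add_tmul, map_add, add_mul, hx, hy]
    | tmul b a =>
      simp only [f]
      rw [leg23_tmul, ← reassoc_of, ← tmul_of_of, H.of_T₁, idTensor_tmul, oneTensor,
        ← reassoc_mul, tmul_mul_tmul, mul_one]
      rfl
  have hE : oneTensor H.E * f (b ⊗ₜ a) = f (b ⊗ₜ a) := by
    simp only [f]
    rw [idTensor_tmul, oneTensor, ← reassoc_mul, tmul_mul_tmul, one_mul]
    exact congrArg (fun m => reassoc (tmul (of b) m)) (H.E_mul_Δ a)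
  apply of_injective H.nondegenerate₃
  change of ((tensorOne H.E).left _) = of (leg23 H.T₁ (H.E.left (b ⊗ₜ a) ⊗ₜ s))
  rw [of_left H.nondegenerate₃, key, key, ← H.idTensor_E.1, mul_assoc (tensorOne H.E), hE,
    mul_assoc]

/-- The right half of `(ι ⊗ Δ)E = (E ⊗ 1)(1 ⊗ E)`; the factor `1 ⊗ E` is absorbed by `Δ`. -/
theorem leg23_T₂_leg13_E_right (x : (A ⊗[ℂ] A) ⊗[ℂ] A) :
    leg23 H.T₂ (leg13 H.E.right x) = leg12 H.E.right (leg23 H.T₂ x) := by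
  refine LinearMap.congr_fun (f := leg23 H.T₂ ∘ₗ leg13 H.E.right)
    (g := leg12 H.E.right ∘ₗ leg23 H.T₂) (TensorProduct.ext_threefold fun q p u => ?_) x
  let f := idTensor (H.Δ : A →ₗ[ℂ] Multiplier (A ⊗[ℂ] A))
  have key : ∀ z, of (leg23 H.T₂ (TensorProduct.rightComm ℂ A A A (z ⊗ₜ p))) =
      oneTensor (tmul (of p) 1) * f z := fun z => by
    induction z with
    | zero => simp
    | add x y hx hy => simp only [TensorProduct.add_tmul, map_add, mul_add, hx, hy]
    | tmul q u =>
      simp only [f]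
      rw [TensorProduct.rightComm_tmul, leg23_tmul, ← reassoc_of, ← tmul_of_of, H.of_T₂,
        idTensor_tmul, oneTensor, ← reassoc_mul, tmul_mul_tmul, one_mul]
      rfl
  have hE : f (q ⊗ₜ u) * oneTensor H.E = f (q ⊗ₜ u) := by
    simp only [f]
    rw [idTensor_tmul, oneTensor, ← reassoc_mul, tmul_mul_tmul, mul_one]
    exact congrArg (fun m => reassoc (tmul (of q) m)) (H.Δ_mul_E u)
  apply of_injective H.nondegenerate₃
  change of (leg23 H.T₂ (TensorProduct.rightComm ℂ A A A (H.E.right (q ⊗ₜ u) ⊗ₜ p))) =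
    of ((tensorOne H.E).right (leg23 H.T₂ (TensorProduct.rightComm ℂ A A A ((q ⊗ₜ u) ⊗ₜ p))))
  rw [of_right H.nondegenerate₃, key, key, ← H.idTensor_E.2.1, H.E_comm, ← mul_assoc (f _), hE,
    mul_assoc]

/-- A linear map on `A` vanishes if it kills the left leg of `Δ`. -/
theorem eq_zero_of_left_leg {W : Type*} [AddCommGroup W] [Module ℂ W] (D : A →ₗ[ℂ] W)
    (h : ∀ (ω : A →ₗ[ℂ] ℂ) (a b : A), D (sliceSnd ω (H.T₁ (a ⊗ₜ b))) = 0) : D = 0 :=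
  LinearMap.ker_eq_top.1 <| H.full_left _ fun a b =>
    mem_range_ker_subtype_rTensor (rTensor_eq_zero_of_slices D _ fun ω => h ω a b)

/-- A linear map on `A` vanishes if it kills the right leg of `Δ`. -/
theorem eq_zero_of_right_leg {W : Type*} [AddCommGroup W] [Module ℂ W] (D : A →ₗ[ℂ] W)
    (h : ∀ c a : A, D.lTensor A (H.T₂ (c ⊗ₜ a)) = 0) : D = 0 :=
  LinearMap.ker_eq_top.1 <| H.full_right _ fun c a => mem_range_ker_subtype_lTensor (h c a)

theorem leg12_T₂_leg23_T₁ (x : (A ⊗[ℂ] A) ⊗[ℂ] A) :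
    leg12 H.T₂ (leg23 H.T₁ x) = leg23 H.T₁ (leg12 H.T₂ x) :=
  LinearMap.congr_fun H.coassoc x

end WeakMultiplierHopfAlgebra

end Canonical

/-! ### The generalized inverse of `T₁` and the antipode -/

section GeneralizedInverse

variable {A : Type*} [NonUnitalRing A] [Module ℂ A] [IsScalarTower ℂ A A] [SMulCommClass ℂ A A]

/-- The map `ι ⊗ ι ⊗ ω` on `A ⊗ A ⊗ A`. -/
def sliceThird (ω : A →ₗ[ℂ] ℂ) : (A ⊗[ℂ] A) ⊗[ℂ] A →ₗ[ℂ] A ⊗[ℂ] A :=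
  (TensorProduct.rid ℂ (A ⊗[ℂ] A)).toLinearMap ∘ₗ ω.lTensor (A ⊗[ℂ] A)

@[simp] theorem sliceThird_tmul (ω : A →ₗ[ℂ] ℂ) (z : A ⊗[ℂ] A) (c : A) :
    sliceThird ω (z ⊗ₜ c) = ω c • z := by
  simp [sliceThird]

theorem sliceThird_assoc_symm (ω : A →ₗ[ℂ] ℂ) (a : A) (z : A ⊗[ℂ] A) :
    sliceThird ω ((TensorProduct.assoc ℂ A A A).symm (a ⊗ₜ z)) = a ⊗ₜ sliceSnd ω z := by
  induction z with
  | zero => simp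
  | add x y hx hy => simp only [TensorProduct.tmul_add, map_add, hx, hy]
  | tmul b c => simp

theorem sliceThird_rightComm (ω : A →ₗ[ℂ] ℂ) (z : A ⊗[ℂ] A) (b : A) :
    sliceThird ω (TensorProduct.rightComm ℂ A A A (z ⊗ₜ b)) = sliceSnd ω z ⊗ₜ b := by
  induction z with
  | zero => simp
  | add x y hx hy => simp only [TensorProduct.add_tmul, map_add, hx, hy]
  | tmul a c => simp [TensorProduct.smul_tmul']

theorem sliceThird_leg12 (ω : A →ₗ[ℂ] ℂ) (T : A ⊗[ℂ] A →ₗ[ℂ] A ⊗[ℂ] A)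
    (x : (A ⊗[ℂ] A) ⊗[ℂ] A) : sliceThird ω (leg12 T x) = T (sliceThird ω x) := by
  induction x with
  | zero => simp
  | add x y hx hy => simp only [map_add, hx, hy]
  | tmul z c => rw [leg12_tmul]; simp

theorem rTensor_sliceSnd_assoc_symm (ω : A →ₗ[ℂ] ℂ) (a : A) (z : A ⊗[ℂ] A) :
    (sliceSnd ω).rTensor A ((TensorProduct.assoc ℂ A A A).symm (a ⊗ₜ z)) =
      a ⊗ₜ sliceFst ω z := by
  induction z with
  | zero => simp
  | add x y hx hy => simp only [TensorProduct.tmul_add, map_add, hx, hy]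
  | tmul b c => simp [TensorProduct.smul_tmul]

theorem rTensor_sliceFst_leg23 (ω : A →ₗ[ℂ] ℂ) (T : A ⊗[ℂ] A →ₗ[ℂ] A ⊗[ℂ] A)
    (x : (A ⊗[ℂ] A) ⊗[ℂ] A) :
    (sliceFst ω).rTensor A (leg23 T x) = T ((sliceFst ω).rTensor A x) := by
  have key : ∀ (a : A) (z : A ⊗[ℂ] A), (sliceFst ω).rTensor A
      ((TensorProduct.assoc ℂ A A A).symm (a ⊗ₜ z)) = ω a • z := fun a z => by
    induction z with
    | zero => simp
    | add x y hx hy => simp only [TensorProduct.tmul_add, map_add, smul_add, hx, hy]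
    | tmul b c => simp [TensorProduct.smul_tmul']
  refine LinearMap.congr_fun (f := (sliceFst ω).rTensor A ∘ₗ leg23 T)
    (g := T ∘ₗ (sliceFst ω).rTensor A) (TensorProduct.ext_threefold fun a b c => ?_) x
  change (sliceFst ω).rTensor A (leg23 T (a ⊗ₜ b ⊗ₜ c)) = T _
  rw [leg23_tmul, key]
  simp [← TensorProduct.smul_tmul']

theorem leg23_comp (T U : A ⊗[ℂ] A →ₗ[ℂ] A ⊗[ℂ] A) (x : (A ⊗[ℂ] A) ⊗[ℂ] A) :
    leg23 (T ∘ₗ U) x = leg23 T (leg23 U x) := by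
  simp [leg23, LinearMap.lTensor_comp]

theorem mul'_rTensor_mulLeft (c : A) (z : A ⊗[ℂ] A) :
    mul' ℂ A ((mulLeft ℂ c).rTensor A z) = c * mul' ℂ A z := by
  induction z with
  | zero => simp
  | add x y hx hy => simp only [map_add, mul_add, hx, hy]
  | tmul a b => simp [mul_assoc]

theorem mul'_lTensor_mulRight (c : A) (z : A ⊗[ℂ] A) :
    mul' ℂ A ((mulRight ℂ c).lTensor A z) = mul' ℂ A z * c := by
  induction z with
  | zero => simp
  | add x y hx hy => simp only [map_add, add_mul, hx, hy]
  | tmul a b => simp [mul_assoc]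

namespace WeakMultiplierHopfAlgebra

variable (H : WeakMultiplierHopfAlgebra A)

theorem sliceFst_ε_T₁ (z : A ⊗[ℂ] A) : sliceFst H.ε (H.T₁ z) = mul' ℂ A z := by
  induction z with
  | zero => simp
  | add x y hx hy => simp only [map_add, hx, hy]
  | tmul a b => simp [H.counit_left]

/-- The projection `G₁` commutes with the left coaction. Both sides are compared on the left leg
of `Δ`, where `G₁` is given by `E`. -/
theorem leg12_T₂_leg23_G₁ (x : (A ⊗[ℂ] A) ⊗[ℂ] A) :
    leg12 H.T₂ (leg23 H.G₁ x) = leg23 H.G₁ (leg12 H.T₂ x) := by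
  refine LinearMap.congr_fun (f := leg12 H.T₂ ∘ₗ leg23 H.G₁)
    (g := leg23 H.G₁ ∘ₗ leg12 H.T₂) (TensorProduct.ext_threefold fun d v b => ?_) x
  let D : A →ₗ[ℂ] (A ⊗[ℂ] A) ⊗[ℂ] A :=
    (leg12 H.T₂ ∘ₗ leg23 H.G₁ - leg23 H.G₁ ∘ₗ leg12 H.T₂) ∘ₗ
      (TensorProduct.mk ℂ (A ⊗[ℂ] A) A).flip b ∘ₗ TensorProduct.mk ℂ A A d
  suffices hD : D = 0 by
    have := LinearMap.congr_fun hD v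
    exact sub_eq_zero.1 this
  refine H.eq_zero_of_left_leg D fun ω a c => ?_
  -- `Q a (b ⊗ c) = (ι ⊗ ω)(Δ(a)(1 ⊗ c)) ⊗ b`. On such elements `G₁` acts by `b ⊗ c ↦ E(b ⊗ c)`,
  -- whereas coassociativity moves `T₂` to act on `a`.
  let Q : A →ₗ[ℂ] A ⊗[ℂ] A →ₗ[ℂ] A ⊗[ℂ] A := TensorProduct.curry
    (sliceThird ω ∘ₗ leg13 H.T₁ ∘ₗ (TensorProduct.assoc ℂ A A A).symm.toLinearMap)
  have hQ : ∀ a b c, Q a (b ⊗ₜ c) = sliceSnd ω (H.T₁ (a ⊗ₜ c)) ⊗ₜ b := fun a b c => by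
    change sliceThird ω (leg13 H.T₁ ((TensorProduct.assoc ℂ A A A).symm (a ⊗ₜ (b ⊗ₜ c)))) = _
    rw [TensorProduct.assoc_symm_tmul, leg13_tmul, sliceThird_rightComm]
  have hG : ∀ a b c, H.G₁ (sliceSnd ω (H.T₁ (a ⊗ₜ c)) ⊗ₜ b) = Q a (H.E.left (b ⊗ₜ c)) :=
    fun a b c => by
      have h := congrArg (sliceThird ω) (LinearMap.congr_fun H.G₁_spec (a ⊗ₜ b ⊗ₜ c))
      simp only [LinearMap.comp_apply] at h
      rw [sliceThird_leg12, leg13_tmul, sliceThird_rightComm] at h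
      exact h
  have hT : ∀ a c, H.T₂ (d ⊗ₜ sliceSnd ω (H.T₁ (a ⊗ₜ c))) =
      sliceThird ω (leg23 H.T₁ (H.T₂ (d ⊗ₜ a) ⊗ₜ c)) := fun a c => by
    rw [← leg12_tmul, ← leg12_T₂_leg23_T₁, sliceThird_leg12, leg23_tmul, sliceThird_assoc_symm]
  let K : A ⊗[ℂ] A → A ⊗[ℂ] A →ₗ[ℂ] (A ⊗[ℂ] A) ⊗[ℂ] A := fun w =>
    (TensorProduct.assoc ℂ A A A).symm.toLinearMap ∘ₗ (Q.flip w).lTensor A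
  have hleft : ∀ w, leg12 H.T₂ ((TensorProduct.assoc ℂ A A A).symm (d ⊗ₜ Q a w)) =
      K w (H.T₂ (d ⊗ₜ a)) := fun w => by
    induction w with
    | zero => simp [K]
    | add x y hx hy =>
      simp only [K] at hx hy ⊢
      simp only [TensorProduct.tmul_add, map_add, hx, hy, LinearMap.lTensor_add,
        LinearMap.comp_apply, LinearMap.add_apply]
    | tmul b c =>
      rw [hQ, TensorProduct.assoc_symm_tmul, leg12_tmul, hT]
      generalize H.T₂ (d ⊗ₜ a) = z
      induction z with
      | zero => simp
      | add x y hx hy => simp only [TensorProduct.add_tmul, map_add, hx, hy]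
      | tmul x y =>
        rw [leg23_tmul, sliceThird_assoc_symm]
        simp [K, hQ]
  have hright : leg23 H.G₁ (H.T₂ (d ⊗ₜ sliceSnd ω (H.T₁ (a ⊗ₜ c))) ⊗ₜ b) =
      K (H.E.left (b ⊗ₜ c)) (H.T₂ (d ⊗ₜ a)) := by
    rw [hT]
    generalize H.T₂ (d ⊗ₜ a) = z
    induction z with
    | zero => simp
    | add x y hx hy => simp only [TensorProduct.add_tmul, map_add, hx, hy]
    | tmul x y =>
      rw [leg23_tmul, sliceThird_assoc_symm, leg23_tmul, hG]
      simp [K]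
  change leg12 H.T₂ (leg23 H.G₁ (d ⊗ₜ _ ⊗ₜ b)) - leg23 H.G₁ (leg12 H.T₂ (d ⊗ₜ _ ⊗ₜ b)) = 0
  rw [sub_eq_zero, leg12_tmul, leg23_tmul, hG, hleft, hright]

variable {R₁ : A ⊗[ℂ] A →ₗ[ℂ] A ⊗[ℂ] A}

/-- The generalized inverse of `T₁` commutes with the left coaction, because it is determined by
`T₁` and two projections that do. -/
theorem leg12_T₂_leg23_R₁ (hE : H.T₁ ∘ₗ R₁ = H.E.left) (hG : R₁ ∘ₗ H.T₁ = H.G₁)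
    (hR : R₁ ∘ₗ H.T₁ ∘ₗ R₁ = R₁) (x : (A ⊗[ℂ] A) ⊗[ℂ] A) :
    leg12 H.T₂ (leg23 R₁ x) = leg23 R₁ (leg12 H.T₂ x) := by
  have h₁ : ∀ y, leg23 R₁ y = leg23 H.G₁ (leg23 R₁ y) := fun y => by
    rw [← leg23_comp, ← hG, LinearMap.comp_assoc, hR]
  have h₂ : ∀ y, leg23 H.G₁ y = leg23 R₁ (leg23 H.T₁ y) := fun y => by
    rw [← leg23_comp, hG]
  have h₃ : ∀ y, leg23 H.T₁ (leg23 R₁ y) = leg23 H.E.left y := fun y => by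
    rw [← leg23_comp, hE]
  rw [h₁, leg12_T₂_leg23_G₁, h₂, ← leg12_T₂_leg23_T₁, h₃, leg12_T₂_leg23_E_left, ← h₃, ← h₂, ← h₁]

/-- `R₁(a ⊗ b) = ∑ a₍₁₎ ⊗ S(a₍₂₎)b`, with `c` covering `a₍₁₎`. -/
theorem rTensor_mulLeft_R₁ {S : A →ₗ[ℂ] A} (hE : H.T₁ ∘ₗ R₁ = H.E.left)
    (hG : R₁ ∘ₗ H.T₁ = H.G₁) (hR : R₁ ∘ₗ H.T₁ ∘ₗ R₁ = R₁)
    (hS : ∀ a b : A, S a * b = sliceFst H.ε (R₁ (a ⊗ₜ b))) (a b c : A) :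
    (mulLeft ℂ c).rTensor A (R₁ (a ⊗ₜ b)) = (mulRight ℂ b ∘ₗ S).lTensor A (H.T₂ (c ⊗ₜ a)) := by
  have h := congrArg ((sliceSnd H.ε).rTensor A) (H.leg12_T₂_leg23_R₁ hE hG hR (c ⊗ₜ a ⊗ₜ b))
  rw [leg23_tmul, leg12_tmul] at h
  have h₁ : ∀ z, (sliceSnd H.ε).rTensor A
      (leg12 H.T₂ ((TensorProduct.assoc ℂ A A A).symm (c ⊗ₜ z))) =
      (mulLeft ℂ c).rTensor A z := fun z => by
    induction z with
    | zero => simp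
    | add x y hx hy => simp only [TensorProduct.tmul_add, map_add, hx, hy]
    | tmul a b => simp [leg12_tmul, H.counit_right]
  have h₂ : ∀ z, (sliceSnd H.ε).rTensor A (leg23 R₁ (z ⊗ₜ b)) =
      (mulRight ℂ b ∘ₗ S).lTensor A z := fun z => by
    induction z with
    | zero => simp
    | add x y hx hy => simp only [TensorProduct.add_tmul, map_add, hx, hy]
    | tmul x y => rw [leg23_tmul, rTensor_sliceSnd_assoc_symm, ← hS]; simp
  rw [h₁, h₂] at h
  exact h

end WeakMultiplierHopfAlgebra

namespace RegularWeakMultiplierHopfAlgebra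

open Multiplier

variable (H : RegularWeakMultiplierHopfAlgebra A)

/-- The multiplier `ε_t(a) = ∑ a₍₁₎ S(a₍₂₎)`. Its left multiplication is written as
`ε_t(a)b = (ε ⊗ ι)(E(a ⊗ b))`. -/
def target (a : A) : Multiplier A :=
  Multiplier.mk (sliceFst H.ε ∘ₗ H.E.left ∘ₗ TensorProduct.mk ℂ A A a)
    (mul' ℂ A ∘ₗ (H.S : A →ₗ[ℂ] A).lTensor A ∘ₗ H.T₂ ∘ₗ (TensorProduct.mk ℂ A A).flip a) (by
      intro c b
      obtain ⟨R₁, R₂, ⟨hE, hG, hR⟩, -, hS, -⟩ := H.isAntipode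
      change mul' ℂ A ((H.S : A →ₗ[ℂ] A).lTensor A (H.T₂ (c ⊗ₜ a))) * b =
        c * sliceFst H.ε (H.E.left (a ⊗ₜ b))
      have h := congrArg (mul' ℂ A) (H.rTensor_mulLeft_R₁ hE hG hR hS a b c)
      rw [LinearMap.lTensor_comp, LinearMap.comp_apply, mul'_rTensor_mulLeft,
        mul'_lTensor_mulRight] at h
      rw [← h, ← hE, LinearMap.comp_apply, H.sliceFst_ε_T₁])

theorem target_left (a b : A) :
    (H.target a).left b = sliceFst H.ε (H.E.left (a ⊗ₜ b)) := rfl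

theorem target_right (a c : A) :
    (H.target a).right c = mul' ℂ A ((H.S : A →ₗ[ℂ] A).lTensor A (H.T₂ (c ⊗ₜ a))) := rfl

theorem mem_targetImage {x : Multiplier A} : x ∈ H.targetImage ↔ ∃ a, H.target a = x := by
  constructor
  · rintro ⟨a, ha⟩
    exact ⟨a, ext_right H.nondegenerate (LinearMap.ext fun c => (ha c).symm)⟩
  · rintro ⟨a, rfl⟩
    exact ⟨a, fun c => rfl⟩

/-- `E` commutes with `ε_t(a) ⊗ 1`: slice the commutation of `E ⊗ 1` and `1 ⊗ E`. -/
theorem E_mul_target (a : A) : H.E * tmul (H.target a) 1 = tmul (H.target a) 1 * H.E := by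
  refine ext_left H.nondegenerate.tensor (TensorProduct.ext' fun b c => ?_)
  have h := congrArg (fun m : Multiplier ((A ⊗[ℂ] A) ⊗[ℂ] A) =>
    (sliceFst H.ε).rTensor A (m.left (a ⊗ₜ b ⊗ₜ c))) H.E_comm
  simp only [left_mul, left_tensorOne, left_oneTensor] at h
  have h₁ : ∀ z, (sliceFst H.ε).rTensor A
      (leg12 H.E.left ((TensorProduct.assoc ℂ A A A).symm (a ⊗ₜ z))) =
      (H.target a).left.rTensor A z := fun z => by
    induction z with
    | zero => simp
    | add x y hx hy => simp only [TensorProduct.tmul_add, map_add, hx, hy]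
    | tmul b c => simp [leg12_tmul, target_left]
  rw [leg23_tmul, h₁, rTensor_sliceFst_leg23, leg12_tmul, LinearMap.rTensor_tmul,
    ← target_left] at h
  exact h.symm

/-- Slicing `(ι ⊗ Δ)E = (E ⊗ 1)(1 ⊗ E)` with the counit in the first leg shows that `Δ` is
left linear over `ε_t(A)` in its first leg. -/
theorem T₁_target_mul (b a s : A) : H.T₁ ((H.target b).left a ⊗ₜ s) =
    (H.target b).left.rTensor A (H.T₁ (a ⊗ₜ s)) := by
  have h := congrArg ((sliceFst H.ε).rTensor A) (H.leg12_E_left_leg23_T₁ (b ⊗ₜ a ⊗ₜ s))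
  have h₁ : ∀ z, (sliceFst H.ε).rTensor A
      (leg12 H.E.left ((TensorProduct.assoc ℂ A A A).symm (b ⊗ₜ z))) =
      (H.target b).left.rTensor A z := fun z => by
    induction z with
    | zero => simp
    | add x y hx hy => simp only [TensorProduct.tmul_add, map_add, hx, hy]
    | tmul b c => simp [leg12_tmul, target_left]
  rw [leg23_tmul, h₁, rTensor_sliceFst_leg23, leg12_tmul, LinearMap.rTensor_tmul,
    ← target_left] at h
  exact h.symm

theorem Δ_target_mul (b a : A) :
    H.Δ ((H.target b).left a) = tmul (H.target b) 1 * H.Δ a := by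
  refine eq_of_mul_one_tmul H.nondegenerate fun s => ?_
  rw [← H.of_T₁, T₁_target_mul, mul_assoc, ← H.of_T₁, ← of_left H.nondegenerate.tensor]
  rfl

/-- `ε_t(A)A = A`, by the counit property. -/
theorem span_target_mul : Submodule.span ℂ {x : A | ∃ a b, x = (H.target a).left b} = ⊤ := by
  rw [eq_top_iff, ← H.idempotent, Submodule.span_le]
  rintro _ ⟨a, b, rfl⟩
  rw [← H.counit_left, ← H.E_left_T₁]
  generalize H.T₁ (a ⊗ₜ b) = z
  induction z with
  | zero => simp
  | add x y hx hy => simp only [map_add]; exact add_mem hx hy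
  | tmul a b => exact Submodule.subset_span ⟨a, b, rfl⟩

/-- If `xε_t(A) ⊆ ε_t(A)`, then `Δ(xa) = (x ⊗ 1)Δ(a)`. -/
theorem Δ_mul_of_mem {x : Multiplier A} (hx : x ∈ H.targetMultiplier) (a : A) :
    H.Δ (x.left a) = tmul x 1 * H.Δ a := by
  have ha : a ∈ Submodule.span ℂ {x : A | ∃ a b, x = (H.target a).left b} :=
    H.span_target_mul ▸ Submodule.mem_top
  induction ha using Submodule.span_induction with
  | zero => simp
  | add a b _ _ ha hb => simp only [map_add, mul_add, ha, hb]
  | smul r a _ ha => simp only [map_smul, ha, mul_smul_comm]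
  | mem a h =>
    obtain ⟨c, b, rfl⟩ := h
    obtain ⟨d, hd⟩ := H.mem_targetImage.1 (hx _ (H.mem_targetImage.2 ⟨c, rfl⟩)).1
    rw [Δ_target_mul, ← mul_assoc, tmul_mul_tmul, one_mul, ← hd, ← Δ_target_mul, hd, left_mul]

theorem E_mul_tmul_of_mem {x : Multiplier A} (hx : x ∈ H.targetMultiplier) :
    H.E * tmul x 1 = tmul x 1 * H.E := by
  refine ext_left H.nondegenerate.tensor (TensorProduct.ext' fun a c => ?_)
  have ha : a ∈ Submodule.span ℂ {x : A | ∃ a b, x = (H.target a).left b} :=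
    H.span_target_mul ▸ Submodule.mem_top
  induction ha using Submodule.span_induction with
  | zero => simp
  | add a b _ _ ha hb => simp only [TensorProduct.add_tmul, map_add, ha, hb]
  | smul r a _ ha => simp only [← TensorProduct.smul_tmul', map_smul, ha]
  | mem a h =>
    obtain ⟨e, b, rfl⟩ := h
    obtain ⟨d, hd⟩ := H.mem_targetImage.1 (hx _ (H.mem_targetImage.2 ⟨e, rfl⟩)).1
    have h₁ : H.E * tmul x 1 * tmul (H.target e) 1 = tmul x 1 * H.E * tmul (H.target e) 1 := by
      rw [mul_assoc, mul_assoc, E_mul_target, tmul_mul_tmul, ← mul_assoc, tmul_mul_tmul, one_mul,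
        ← hd, E_mul_target]
    exact congrArg (fun m : Multiplier (A ⊗[ℂ] A) => m.left (b ⊗ₜ c)) h₁

/-- `Δ(ax) = Δ(a)(x ⊗ 1)` follows from `Δ(xb) = (x ⊗ 1)Δ(b)` by cancelling `Δ(b)`. -/
theorem Δ_right_eq {x : Multiplier A} (h : ∀ b, H.Δ (x.left b) = tmul x 1 * H.Δ b)
    (hE : H.E * tmul x 1 = tmul x 1 * H.E) (a : A) :
    H.Δ (x.right a) = H.Δ a * tmul x 1 := by
  have h₁ : H.Δ (x.right a) * H.E = H.Δ a * tmul x 1 * H.E :=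
    H.mul_E_eq_of_mul_Δ_eq fun b => by
      rw [← map_mul, right_mul_eq, map_mul, h, mul_assoc]
  rw [← H.Δ_mul_E (x.right a), h₁, mul_assoc, ← hE, ← mul_assoc, H.Δ_mul_E]

theorem T₂_right_eq {x : Multiplier A} (h : ∀ a, H.Δ (x.right a) = H.Δ a * tmul x 1) (c a : A) :
    H.T₂ (c ⊗ₜ x.right a) = x.right.rTensor A (H.T₂ (c ⊗ₜ a)) := by
  apply of_injective H.nondegenerate.tensor
  change _ = of ((tmul x 1).right _)
  rw [of_right H.nondegenerate.tensor, H.of_T₂, H.of_T₂, h, mul_assoc]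

theorem target_mul_target (a b : A) :
    H.target a * H.target b = H.target ((H.target a).left b) := by
  refine ext_right H.nondegenerate (LinearMap.ext fun c => ?_)
  have : H.T₂ (c ⊗ₜ (H.target a).left b) = H.T₂ ((H.target a).right c ⊗ₜ b) := by
    apply of_injective H.nondegenerate.tensor
    rw [H.of_T₂, H.of_T₂, Δ_target_mul, ← mul_assoc, tmul_mul_tmul, mul_one,
      of_right H.nondegenerate]
  rw [right_mul, H.target_right b, H.target_right ((H.target a).left b), this]

/-- `ε_t(A)` is closed under products. -/
theorem targetImage_subset : H.targetImage ⊆ H.targetMultiplier := by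
  intro x hx y hy
  obtain ⟨a, rfl⟩ := H.mem_targetImage.1 hx
  obtain ⟨b, rfl⟩ := H.mem_targetImage.1 hy
  exact ⟨H.mem_targetImage.2 ⟨_, (H.target_mul_target a b).symm⟩,
    H.mem_targetImage.2 ⟨_, (H.target_mul_target b a).symm⟩⟩

end RegularWeakMultiplierHopfAlgebra

end GeneralizedInverse

/-! ### The pentagon identity and the range of `T₃` -/

section Pentagon

open Multiplier

variable {A : Type*} [NonUnitalRing A] [Module ℂ A] [IsScalarTower ℂ A A] [SMulCommClass ℂ A A]

theorem Multiplier.right_rTensor_mulLeft (hA : IsNondegenerateProduct A)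
    (m : Multiplier (A ⊗[ℂ] A)) (q : A) (z : A ⊗[ℂ] A) :
    m.right ((mulLeft ℂ q).rTensor A z) = (mulLeft ℂ q).rTensor A (m.right z) := by
  apply of_injective hA.tensor
  change of (m.right ((tmul (of q) 1).left z)) = of ((tmul (of q) 1).left (m.right z))
  rw [of_right hA.tensor, of_left hA.tensor, of_left hA.tensor, of_right hA.tensor, mul_assoc]

namespace WeakMultiplierHopfAlgebra

variable (H : WeakMultiplierHopfAlgebra A)

/-- The bilinear map `(z, a) ↦ zΔ(a)`. -/
def mulΔ : A ⊗[ℂ] A →ₗ[ℂ] A →ₗ[ℂ] A ⊗[ℂ] A :=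
  LinearMap.mk₂ ℂ (fun z a => (H.Δ a).right z) (by simp) (by simp) (by simp) (by simp)

@[simp] theorem mulΔ_apply (z : A ⊗[ℂ] A) (a : A) : H.mulΔ z a = (H.Δ a).right z := rfl

/-- `(z ⊗ 1)Δ⁽²⁾(u)(1 ⊗ 1 ⊗ b) = (z ⊗ 1)(Δ ⊗ ι)(Δ(u)(1 ⊗ b))`. -/
theorem leg23_T₂_leg13_T₂_mul (z : A ⊗[ℂ] A) (u b : A) :
    (mulRight ℂ b).lTensor (A ⊗[ℂ] A) (leg23 H.T₂ (leg13 H.T₂ (z ⊗ₜ u))) =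
      (H.mulΔ z).rTensor A (H.T₁ (u ⊗ₜ b)) := by
  induction z with
  | zero => simp
  | add x y hx hy =>
    simp only [TensorProduct.add_tmul, map_add, hx, hy, LinearMap.rTensor_add,
      LinearMap.add_apply]
  | tmul c d =>
    have h₀ : ∀ (x : A) (t : A ⊗[ℂ] A), (mulRight ℂ b).lTensor (A ⊗[ℂ] A)
        ((TensorProduct.assoc ℂ A A A).symm (x ⊗ₜ t)) =
        (TensorProduct.assoc ℂ A A A).symm (x ⊗ₜ (mulRight ℂ b).lTensor A t) := fun x t => by
      induction t with
      | zero => simp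
      | add x y hx hy => simp only [TensorProduct.tmul_add, map_add, hx, hy]
      | tmul y z => simp
    have h₁ : ∀ (x : A) (t : A ⊗[ℂ] A), ((mulLeft ℂ d).lTensor A).rTensor A
        ((TensorProduct.assoc ℂ A A A).symm (x ⊗ₜ t)) =
        (TensorProduct.assoc ℂ A A A).symm (x ⊗ₜ (mulLeft ℂ d).rTensor A t) := fun x t => by
      induction t with
      | zero => simp
      | add x y hx hy => simp only [TensorProduct.tmul_add, map_add, hx, hy]
      | tmul y z => simp
    have h₂ : ∀ w, (mulRight ℂ b).lTensor (A ⊗[ℂ] A)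
        (leg23 H.T₂ (TensorProduct.rightComm ℂ A A A (w ⊗ₜ d))) =
        ((mulLeft ℂ d).lTensor A).rTensor A (leg23 H.T₁ (w ⊗ₜ b)) := fun w => by
      induction w with
      | zero => simp
      | add x y hx hy => simp only [TensorProduct.add_tmul, map_add, hx, hy]
      | tmul x v =>
        rw [TensorProduct.rightComm_tmul, leg23_tmul, leg23_tmul, h₀, h₁, rTensor_mulLeft_T₁]
    have h₃ : ∀ t, ((mulLeft ℂ d).lTensor A).rTensor A
        (leg12 H.T₂ ((TensorProduct.assoc ℂ A A A).symm (c ⊗ₜ t))) =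
        (H.mulΔ (c ⊗ₜ d)).rTensor A t := fun t => by
      induction t with
      | zero => simp
      | add x y hx hy => simp only [TensorProduct.tmul_add, map_add, hx, hy]
      | tmul x y => simp [leg12_tmul, lTensor_mulLeft_T₂]
    rw [leg13_tmul, h₂, ← leg12_tmul, ← leg12_T₂_leg23_T₁, leg23_tmul, h₃]

/-- `zEΔ⁽²⁾(u) = zΔ⁽²⁾(u)`, with `E` in the first two legs. -/
theorem leg23_T₂_leg13_T₂_E_right (z : A ⊗[ℂ] A) (u : A) :
    leg23 H.T₂ (leg13 H.T₂ (H.E.right z ⊗ₜ u)) = leg23 H.T₂ (leg13 H.T₂ (z ⊗ₜ u)) := by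
  refine H.nondegenerate.eq_of_lTensor_mulRight fun b => ?_
  have : H.mulΔ (H.E.right z) = H.mulΔ z := LinearMap.ext fun a => H.Δ_right_E_right a z
  rw [leg23_T₂_leg13_T₂_mul, leg23_T₂_leg13_T₂_mul, this]

/-- The pentagon identity for `T₂`. -/
theorem pentagon_T₂ (s r u : A) :
    leg23 H.T₂ (leg13 H.T₂ (H.T₂ (s ⊗ₜ r) ⊗ₜ u)) = leg12 H.T₂ (leg23 H.T₂ (s ⊗ₜ r ⊗ₜ u)) := by
  refine H.nondegenerate.eq_of_lTensor_mulRight fun b => ?_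
  have h₁ : ∀ t : A ⊗[ℂ] A, (mulRight ℂ b).lTensor (A ⊗[ℂ] A)
      (leg12 H.T₂ ((TensorProduct.assoc ℂ A A A).symm (s ⊗ₜ t))) =
      leg12 H.T₂ ((TensorProduct.assoc ℂ A A A).symm (s ⊗ₜ (mulRight ℂ b).lTensor A t)) :=
    fun t => by
      induction t with
      | zero => simp
      | add x y hx hy => simp only [TensorProduct.tmul_add, map_add, hx, hy]
      | tmul y z => simp [leg12_tmul]
  have h₂ : ∀ t : A ⊗[ℂ] A, leg12 H.T₂ ((TensorProduct.assoc ℂ A A A).symm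
      (s ⊗ₜ (mulLeft ℂ r).rTensor A t)) = (H.mulΔ (H.T₂ (s ⊗ₜ r))).rTensor A t := fun t => by
    induction t with
    | zero => simp
    | add x y hx hy => simp only [TensorProduct.tmul_add, map_add, hx, hy]
    | tmul y z => simp [leg12_tmul, T₂_mul]
  rw [leg23_T₂_leg13_T₂_mul, leg23_tmul, h₁, ← rTensor_mulLeft_T₁, h₂]

end WeakMultiplierHopfAlgebra

namespace RegularWeakMultiplierHopfAlgebra

variable (H : RegularWeakMultiplierHopfAlgebra A)

theorem rTensor_mulLeft_T₃ (c a b : A) :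
    (mulLeft ℂ c).rTensor A (H.T₃ (a ⊗ₜ b)) = (H.Δ a).right (c ⊗ₜ b) := by
  apply of_injective H.nondegenerate.tensor
  change of ((tmul (of c) 1).left _) = _
  rw [of_left H.nondegenerate.tensor, of_right H.nondegenerate.tensor, H.of_T₃, ← mul_assoc,
    tmul_mul_tmul, one_mul, mul_one, tmul_of_of]

/-- The linear map `z ⊗ a ↦ zΔ(S(a))`. -/
def mulΔS : (A ⊗[ℂ] A) ⊗[ℂ] A →ₗ[ℂ] A ⊗[ℂ] A :=
  TensorProduct.lift (H.mulΔ.compl₂ (H.S : A →ₗ[ℂ] A))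

theorem mulΔS_tmul (z : A ⊗[ℂ] A) (a : A) : H.mulΔS (z ⊗ₜ a) = (H.Δ (H.S a)).right z := by
  simp [mulΔS]

theorem mulΔS_leg12_E_right (x : (A ⊗[ℂ] A) ⊗[ℂ] A) :
    H.mulΔS (leg12 H.E.right x) = H.mulΔS x := by
  induction x with
  | zero => simp
  | add x y hx hy => simp only [map_add, hx, hy]
  | tmul z a => rw [leg12_tmul, mulΔS_tmul, mulΔS_tmul, H.Δ_right_E_right]

/-- `∑ zΔ⁽²⁾(u)` with `S` applied to the last leg and multiplied in through `Δ` is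
`z(ε_t(u) ⊗ 1)E`. -/
theorem mulΔS_leg23_T₂_leg13_T₂ (z : A ⊗[ℂ] A) (u : A) :
    H.mulΔS (leg23 H.T₂ (leg13 H.T₂ (z ⊗ₜ u))) =
      H.E.right ((H.target u).right.rTensor A z) := by
  have h₁ : ∀ w, H.mulΔS (leg23 H.T₂ (leg13 H.T₂ (H.T₂ w ⊗ₜ u))) =
      (H.target u).right.rTensor A (H.T₂ w) := fun w => by
    induction w with
    | zero => simp
    | add x y hx hy => simp only [TensorProduct.add_tmul, map_add, hx, hy]
    | tmul s r =>
      have h : ∀ t, H.mulΔS (leg12 H.T₂ ((TensorProduct.assoc ℂ A A A).symm (s ⊗ₜ t))) =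
          H.T₂ (s ⊗ₜ mul' ℂ A ((H.S : A →ₗ[ℂ] A).lTensor A t)) := fun t => by
        induction t with
        | zero => simp
        | add x y hx hy => simp only [TensorProduct.tmul_add, map_add, hx, hy]
        | tmul x y => simp [leg12_tmul, mulΔS_tmul, H.T₂_mul]
      rw [H.pentagon_T₂, leg23_tmul, h, ← target_right, H.T₂_right_eq
        (H.Δ_right_eq (H.Δ_target_mul u) (H.E_mul_target u))]
  obtain ⟨w, hw⟩ := H.exists_T₂_eq_E_right z
  rw [← H.leg23_T₂_leg13_T₂_E_right, ← hw, h₁, hw]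
  exact congrArg (fun m : Multiplier (A ⊗[ℂ] A) => m.right z) (H.E_mul_target u)

/-- `∑ (1 ⊗ pu₍₁₎)Δ(S(u₍₂₎)) = (S(u) ⊗ p)E`. Covering the first leg by `q`, both sides become maps
of `q ⊗ u` that agree on `(A ⊗ A)Δ(A)` and do not change when `q ⊗ u` is multiplied by `E`. -/
theorem T₃_comm_lTensor_S_T₂ (p u : A) :
    H.T₃ (TensorProduct.comm ℂ A A ((H.S : A →ₗ[ℂ] A).lTensor A (H.T₂ (p ⊗ₜ u)))) =
      H.E.right (H.S u ⊗ₜ p) := by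
  obtain ⟨R₁, R₂, -, ⟨hE, hG, hR⟩, -, hS⟩ := H.isAntipode
  -- `f(q ⊗ u) = ∑ (q ⊗ pu₍₁₎)Δ(S(u₍₂₎))` and `g(q ⊗ u) = (qS(u) ⊗ p)E`
  let f : A ⊗[ℂ] A →ₗ[ℂ] A ⊗[ℂ] A := H.mulΔS ∘ₗ leg23 H.T₂ ∘ₗ
    (TensorProduct.rightComm ℂ A A A).toLinearMap ∘ₗ (TensorProduct.mk ℂ (A ⊗[ℂ] A) A).flip p
  let g : A ⊗[ℂ] A →ₗ[ℂ] A ⊗[ℂ] A := H.E.right ∘ₗ (TensorProduct.mk ℂ A A).flip p ∘ₗ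
    mul' ℂ A ∘ₗ (H.S : A →ₗ[ℂ] A).lTensor A
  have hf : ∀ w, f w = H.mulΔS (leg23 H.T₂ (TensorProduct.rightComm ℂ A A A (w ⊗ₜ p))) :=
    fun w => rfl
  have hg : ∀ w, g w = H.E.right (mul' ℂ A ((H.S : A →ₗ[ℂ] A).lTensor A w) ⊗ₜ p) :=
    fun w => rfl
  have hfg : f ∘ₗ H.T₂ = g ∘ₗ H.T₂ := TensorProduct.ext' fun q u => by
    change f (H.T₂ _) = g (H.T₂ _)
    rw [hf, hg, ← leg13_tmul,
      mulΔS_leg23_T₂_leg13_T₂, ← target_right, LinearMap.rTensor_tmul]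
  have hfE : f ∘ₗ H.E.right = f := TensorProduct.ext' fun q u => by
    change f (H.E.right _) = _
    rw [hf, ← leg13_tmul, H.leg23_T₂_leg13_E_right, mulΔS_leg12_E_right,
      hf, TensorProduct.rightComm_tmul]
  have hgE : g ∘ₗ H.E.right = g := by
    -- `mul' ∘ (ι ⊗ S) = (ι ⊗ ε) ∘ R₂`, and `R₂` absorbs `E`
    have h : mul' ℂ A ∘ₗ (H.S : A →ₗ[ℂ] A).lTensor A = sliceSnd H.ε ∘ₗ R₂ :=
      TensorProduct.ext' fun q u => by simp [← hS]
    simp only [g]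
    rw [h, ← hE]
    simp only [LinearMap.comp_assoc]
    rw [hR]
  have key : ∀ w, f w = g w := fun w => by
    obtain ⟨v, hv⟩ := H.exists_T₂_eq_E_right w
    rw [← hfE, ← hgE]
    change f (H.E.right w) = g (H.E.right w)
    rw [← hv]
    exact LinearMap.congr_fun hfg v
  refine H.nondegenerate.eq_of_rTensor_mulLeft fun q => ?_
  have h₁ : ∀ t, H.mulΔS ((TensorProduct.assoc ℂ A A A).symm (q ⊗ₜ t)) =
      (mulLeft ℂ q).rTensor A
        (H.T₃ (TensorProduct.comm ℂ A A ((H.S : A →ₗ[ℂ] A).lTensor A t))) := fun t => by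
    induction t with
    | zero => simp
    | add x y hx hy => simp only [TensorProduct.tmul_add, map_add, hx, hy]
    | tmul x y => simp [mulΔS_tmul, rTensor_mulLeft_T₃]
  have h₂ := key (q ⊗ₜ u)
  rw [hf, hg, TensorProduct.rightComm_tmul, leg23_tmul, h₁] at h₂
  rw [h₂, ← right_rTensor_mulLeft H.nondegenerate]
  simp

/-- `(A ⊗ A)E ⊆ (1 ⊗ A)Δ(A)`. This uses that the antipode is surjective. -/
theorem range_E_right_le : LinearMap.range H.E.right ≤ LinearMap.range H.T₃ := by
  rintro _ ⟨z, rfl⟩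
  induction z with
  | zero => simp
  | add x y hx hy => rw [map_add]; exact add_mem hx hy
  | tmul a p =>
    obtain ⟨u, rfl⟩ := H.S.surjective a
    exact ⟨_, H.T₃_comm_lTensor_S_T₂ p u⟩

end RegularWeakMultiplierHopfAlgebra

end Pentagon

/-! ### The opposite algebra with the opposite coproduct -/

section Opposite

open Multiplier WeakMultiplierHopfAlgebra

variable {A : Type*} [NonUnitalRing A] [Module ℂ A] [IsScalarTower ℂ A A] [SMulCommClass ℂ A A]
variable {B : Type*} [NonUnitalRing B] [Module ℂ B] [IsScalarTower ℂ B B] [SMulCommClass ℂ B B]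

/-- Transport of multipliers along a linear anti-isomorphism of algebras; left and right
multiplications are exchanged. -/
def Multiplier.antiConj (e : A ≃ₗ[ℂ] B) (he : ∀ x y : A, e (x * y) = e y * e x) :
    Multiplier A →ₗ[ℂ] Multiplier B where
  toFun m := mk (e.conj m.right) (e.conj m.left) (by
      intro x y
      obtain ⟨x, rfl⟩ := e.surjective x
      obtain ⟨y, rfl⟩ := e.surjective y
      simp [LinearEquiv.conj_apply, ← he, right_mul_eq])
  map_add' m n := ext' (by simp) (by simp)
  map_smul' r m := ext' (by simp) (by simp)

section antiConj

variable (e : A ≃ₗ[ℂ] B) (he : ∀ x y : A, e (x * y) = e y * e x)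

@[simp] theorem Multiplier.left_antiConj (m : Multiplier A) :
    (antiConj e he m).left = e.conj m.right := rfl

@[simp] theorem Multiplier.right_antiConj (m : Multiplier A) :
    (antiConj e he m).right = e.conj m.left := rfl

theorem Multiplier.antiConj_mul (m n : Multiplier A) :
    antiConj e he (m * n) = antiConj e he n * antiConj e he m := by
  refine ext' (LinearMap.ext fun x => ?_) (LinearMap.ext fun x => ?_) <;>
    simp [LinearEquiv.conj_apply]

theorem Multiplier.antiConj_one : antiConj e he 1 = 1 := by
  refine ext' (LinearMap.ext fun x => ?_) (LinearMap.ext fun x => ?_) <;>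
    simp [LinearEquiv.conj_apply]

theorem Multiplier.antiConj_of (a : A) : antiConj e he (of a) = of (e a) := by
  refine ext' (LinearMap.ext fun x => ?_) (LinearMap.ext fun x => ?_) <;>
    simp [LinearEquiv.conj_apply, he]

theorem Multiplier.antiConj_surjective (n : Multiplier B) : ∃ m, antiConj e he m = n := by
  refine ⟨mk (e.symm.conj n.right) (e.symm.conj n.left) fun a b => ?_, ?_⟩
  · apply e.injective
    simp [LinearEquiv.conj_apply, he, right_mul_eq]
  · refine ext' (LinearMap.ext fun x => ?_) (LinearMap.ext fun x => ?_) <;>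
      simp [LinearEquiv.conj_apply]

end antiConj

theorem Multiplier.IsExtensionValue.antiConj {C D : Type*} [NonUnitalRing C] [Module ℂ C]
    [IsScalarTower ℂ C C] [SMulCommClass ℂ C C] [NonUnitalRing D] [Module ℂ D]
    [IsScalarTower ℂ D D] [SMulCommClass ℂ D D]
    (e : A ≃ₗ[ℂ] B) (he : ∀ x y : A, e (x * y) = e y * e x)
    (e' : C ≃ₗ[ℂ] D) (he' : ∀ x y : C, e' (x * y) = e' y * e' x)
    {f : A →ₗ[ℂ] Multiplier C} {p : Multiplier C} {m : Multiplier A} {y : Multiplier C}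
    (h : IsExtensionValue f p m y) :
    IsExtensionValue (Multiplier.antiConj e' he' ∘ₗ f ∘ₗ e.symm.toLinearMap)
      (Multiplier.antiConj e' he' p) (Multiplier.antiConj e he m)
      (Multiplier.antiConj e' he' y) := by
  refine ⟨fun x => ?_, fun x => ?_, ?_, ?_⟩
  · simp [← antiConj_mul, h.2.1, LinearEquiv.conj_apply]
  · simp [← antiConj_mul, h.1, LinearEquiv.conj_apply]
  · rw [← antiConj_mul, h.2.2.2]
  · rw [← antiConj_mul, h.2.2.1]

theorem LinearEquiv.range_conj {V W : Type*} [AddCommGroup V] [Module ℂ V] [AddCommGroup W]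
    [Module ℂ W] (e : V ≃ₗ[ℂ] W) (T : V →ₗ[ℂ] V) :
    LinearMap.range (e.conj T) = (LinearMap.range T).map (e : V →ₗ[ℂ] W) := by
  rw [LinearEquiv.conj_apply, LinearMap.range_comp_of_range_eq_top _ e.symm.range,
    LinearMap.range_comp]

theorem LinearEquiv.ker_conj {V W : Type*} [AddCommGroup V] [Module ℂ V] [AddCommGroup W]
    [Module ℂ W] (e : V ≃ₗ[ℂ] W) (T : V →ₗ[ℂ] V) :
    LinearMap.ker (e.conj T) = (LinearMap.ker T).map (e : V →ₗ[ℂ] W) := by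
  ext x
  obtain ⟨x, rfl⟩ := e.surjective x
  simp [LinearEquiv.conj_apply]

/-- The flip `a ⊗ b ↦ e(b) ⊗ e(a)` from `A ⊗ A` to `B ⊗ B`. -/
def flip₂ (e : A ≃ₗ[ℂ] B) : A ⊗[ℂ] A ≃ₗ[ℂ] B ⊗[ℂ] B :=
  TensorProduct.comm ℂ A A ≪≫ₗ TensorProduct.congr e e

/-- The map `a ⊗ b ⊗ c ↦ e(c) ⊗ e(b) ⊗ e(a)` from `A ⊗ A ⊗ A` to `B ⊗ B ⊗ B`. -/
def flip₃ (e : A ≃ₗ[ℂ] B) : (A ⊗[ℂ] A) ⊗[ℂ] A ≃ₗ[ℂ] (B ⊗[ℂ] B) ⊗[ℂ] B :=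
  TensorProduct.assoc ℂ A A A ≪≫ₗ TensorProduct.comm ℂ A (A ⊗[ℂ] A) ≪≫ₗ
    TensorProduct.congr (flip₂ e) e

section Flip

variable (e : A ≃ₗ[ℂ] B) (he : ∀ x y : A, e (x * y) = e y * e x)

@[simp] theorem flip₂_tmul (a b : A) : flip₂ e (a ⊗ₜ b) = e b ⊗ₜ e a := rfl

@[simp] theorem flip₂_symm_tmul (a b : B) :
    (flip₂ e).symm (a ⊗ₜ b) = e.symm b ⊗ₜ e.symm a := rfl

theorem flip₂_mul (he : ∀ x y : A, e (x * y) = e y * e x) (x y : A ⊗[ℂ] A) :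
    flip₂ e (x * y) = flip₂ e y * flip₂ e x := by
  induction x with
  | zero => simp
  | add x x' hx hx' => simp only [add_mul, mul_add, map_add, hx, hx']
  | tmul a b =>
    induction y with
    | zero => simp
    | add y y' hy hy' => simp only [add_mul, mul_add, map_add, hy, hy']
    | tmul c d => simp [he]

@[simp] theorem flip₃_tmul (a b c : A) :
    flip₃ e (a ⊗ₜ b ⊗ₜ c) = e c ⊗ₜ e b ⊗ₜ e a := rfl

@[simp] theorem flip₃_symm_tmul (a b c : B) :
    (flip₃ e).symm (a ⊗ₜ b ⊗ₜ c) = e.symm c ⊗ₜ e.symm b ⊗ₜ e.symm a := rfl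

theorem flip₃_assoc_symm (a : A) (z : A ⊗[ℂ] A) :
    flip₃ e ((TensorProduct.assoc ℂ A A A).symm (a ⊗ₜ z)) = flip₂ e z ⊗ₜ e a := by
  simp [flip₃]

theorem flip₃_tmul_right (z : A ⊗[ℂ] A) (c : A) : flip₃ e (z ⊗ₜ c) =
    (TensorProduct.assoc ℂ B B B).symm (e c ⊗ₜ flip₂ e z) := by
  induction z with
  | zero => simp
  | add x y hx hy => simp only [TensorProduct.add_tmul, TensorProduct.tmul_add, map_add, hx, hy]
  | tmul a b => simp

theorem flip₃_rightComm (z : A ⊗[ℂ] A) (b : A) :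
    flip₃ e (TensorProduct.rightComm ℂ A A A (z ⊗ₜ b)) =
      TensorProduct.rightComm ℂ B B B (flip₂ e z ⊗ₜ e b) := by
  induction z with
  | zero => simp
  | add x y hx hy => simp only [TensorProduct.add_tmul, map_add, hx, hy]
  | tmul a c => simp

theorem flip₃_mul (he : ∀ x y : A, e (x * y) = e y * e x)
    (x y : (A ⊗[ℂ] A) ⊗[ℂ] A) :
    flip₃ e (x * y) = flip₃ e y * flip₃ e x := by
  induction x with
  | zero => simp
  | add x x' hx hx' => simp only [add_mul, mul_add, map_add, hx, hx']
  | tmul z a =>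
    induction y with
    | zero => simp
    | add y y' hy hy' => simp only [add_mul, mul_add, map_add, hy, hy']
    | tmul w b =>
      rw [Algebra.TensorProduct.tmul_mul_tmul, flip₃_tmul_right, flip₃_tmul_right,
        flip₃_tmul_right, ← tensor_assoc_symm_mul, Algebra.TensorProduct.tmul_mul_tmul,
        flip₂_mul e he, he]

theorem leg12_conj (T : A ⊗[ℂ] A →ₗ[ℂ] A ⊗[ℂ] A) :
    leg12 ((flip₂ e).conj T) = (flip₃ e).conj (leg23 T) := by
  refine TensorProduct.ext_threefold fun a b c => ?_
  rw [leg12_tmul, LinearEquiv.conj_apply_apply, LinearEquiv.conj_apply_apply, flip₃_symm_tmul,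
    leg23_tmul, flip₃_assoc_symm, flip₂_symm_tmul, LinearEquiv.apply_symm_apply]

theorem leg23_conj (T : A ⊗[ℂ] A →ₗ[ℂ] A ⊗[ℂ] A) :
    leg23 ((flip₂ e).conj T) = (flip₃ e).conj (leg12 T) := by
  refine TensorProduct.ext_threefold fun a b c => ?_
  rw [leg23_tmul, LinearEquiv.conj_apply_apply, LinearEquiv.conj_apply_apply, flip₃_symm_tmul,
    leg12_tmul, flip₃_tmul_right, flip₂_symm_tmul, LinearEquiv.apply_symm_apply]

theorem leg13_conj (T : A ⊗[ℂ] A →ₗ[ℂ] A ⊗[ℂ] A) :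
    leg13 ((flip₂ e).conj T) = (flip₃ e).conj (leg13 T) := by
  refine TensorProduct.ext_threefold fun a b c => ?_
  rw [leg13_tmul, LinearEquiv.conj_apply_apply, LinearEquiv.conj_apply_apply, flip₃_symm_tmul,
    leg13_tmul, flip₃_rightComm, flip₂_symm_tmul, LinearEquiv.apply_symm_apply]

theorem sliceFst_flip₂ (φ : A →ₗ[ℂ] ℂ) (z : A ⊗[ℂ] A) :
    sliceFst (φ ∘ₗ e.symm.toLinearMap) (flip₂ e z) = e (sliceSnd φ z) := by
  induction z with
  | zero => simp
  | add x y hx hy => simp only [map_add, hx, hy]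
  | tmul a b => simp

theorem sliceSnd_flip₂ (φ : A →ₗ[ℂ] ℂ) (z : A ⊗[ℂ] A) :
    sliceSnd (φ ∘ₗ e.symm.toLinearMap) (flip₂ e z) = e (sliceFst φ z) := by
  induction z with
  | zero => simp
  | add x y hx hy => simp only [map_add, hx, hy]
  | tmul a b => simp

theorem Multiplier.antiConj_tmul (m n : Multiplier A) :
    antiConj (flip₂ e) (flip₂_mul e he) (tmul m n) =
      tmul (antiConj e he n) (antiConj e he m) := by
  refine ext' (TensorProduct.ext' fun a b => ?_) (TensorProduct.ext' fun a b => ?_) <;>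
    simp [LinearEquiv.conj_apply]

theorem Multiplier.tmul_antiConj (m : Multiplier (A ⊗[ℂ] A)) (n : Multiplier A) :
    tmul (antiConj (flip₂ e) (flip₂_mul e he) m) (antiConj e he n) =
      antiConj (flip₃ e) (flip₃_mul e he) (reassoc (tmul n m)) := by
  refine ext' (TensorProduct.ext_threefold fun a b c => ?_)
    (TensorProduct.ext_threefold fun a b c => ?_) <;>
    simp [LinearEquiv.conj_apply, reassoc, flip₃_assoc_symm]

theorem Multiplier.reassoc_tmul_antiConj (m : Multiplier (A ⊗[ℂ] A)) (n : Multiplier A) :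
    reassoc (tmul (antiConj e he n) (antiConj (flip₂ e) (flip₂_mul e he) m)) =
      antiConj (flip₃ e) (flip₃_mul e he) (tmul m n) := by
  refine ext' (TensorProduct.ext_threefold fun a b c => ?_)
    (TensorProduct.ext_threefold fun a b c => ?_) <;>
    simp [LinearEquiv.conj_apply, reassoc, flip₃_tmul_right]

theorem Multiplier.tensorOne_antiConj (m : Multiplier (A ⊗[ℂ] A)) :
    tensorOne (antiConj (flip₂ e) (flip₂_mul e he) m) =
      antiConj (flip₃ e) (flip₃_mul e he) (oneTensor m) := by
  rw [tensorOne, oneTensor, ← tmul_antiConj e he, antiConj_one]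

theorem Multiplier.oneTensor_antiConj (m : Multiplier (A ⊗[ℂ] A)) :
    oneTensor (antiConj (flip₂ e) (flip₂_mul e he) m) =
      antiConj (flip₃ e) (flip₃_mul e he) (tensorOne m) := by
  rw [tensorOne, oneTensor, ← reassoc_tmul_antiConj e he, antiConj_one]

theorem IsNondegenerateProduct.of_antiEquiv (he : ∀ x y : A, e (x * y) = e y * e x)
    (hA : IsNondegenerateProduct A) :
    IsNondegenerateProduct B := by
  refine ⟨fun a h => ?_, fun a h => ?_⟩
  · refine e.symm.map_eq_zero_iff.1 (hA.2 _ fun b => e.injective ?_)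
    rw [he, LinearEquiv.apply_symm_apply, h, map_zero]
  · refine e.symm.map_eq_zero_iff.1 (hA.1 _ fun b => e.injective ?_)
    rw [he, LinearEquiv.apply_symm_apply, h, map_zero]

end Flip

namespace WeakMultiplierHopfAlgebra

variable (H : WeakMultiplierHopfAlgebra A)
variable (e : A ≃ₗ[ℂ] B) (he : ∀ x y : A, e (x * y) = e y * e x)

/-- The opposite coproduct, on an algebra anti-isomorphic to `A`. -/
def Δop : B →ₙₐ[ℂ] Multiplier (B ⊗[ℂ] B) where
  toFun b := antiConj (flip₂ e) (flip₂_mul e he) (H.Δ (e.symm b))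
  map_smul' r a := by simp
  map_zero' := by simp
  map_add' a b := by simp
  map_mul' a b := by
    have : e.symm (a * b) = e.symm b * e.symm a := e.injective (by simp [he])
    rw [this, map_mul, antiConj_mul]

theorem Δop_apply (b : B) :
    H.Δop e he b = antiConj (flip₂ e) (flip₂_mul e he) (H.Δ (e.symm b)) := rfl

theorem antiConj_of_symm (b : B) : antiConj e he (of (e.symm b)) = of b := by
  rw [antiConj_of, LinearEquiv.apply_symm_apply]

theorem tensorId_Δop : tensorId (H.Δop e he : B →ₗ[ℂ] Multiplier (B ⊗[ℂ] B)) =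
    antiConj (flip₃ e) (flip₃_mul e he) ∘ₗ
      idTensor (H.Δ : A →ₗ[ℂ] Multiplier (A ⊗[ℂ] A)) ∘ₗ (flip₂ e).symm.toLinearMap := by
  refine TensorProduct.ext' fun a b => ?_
  simp only [LinearMap.comp_apply, LinearEquiv.coe_coe, flip₂_symm_tmul, idTensor_tmul,
    tensorId_tmul]
  rw [← tmul_antiConj e he, antiConj_of_symm e he]
  rfl

theorem idTensor_Δop : idTensor (H.Δop e he : B →ₗ[ℂ] Multiplier (B ⊗[ℂ] B)) =
    antiConj (flip₃ e) (flip₃_mul e he) ∘ₗ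
      tensorId (H.Δ : A →ₗ[ℂ] Multiplier (A ⊗[ℂ] A)) ∘ₗ (flip₂ e).symm.toLinearMap := by
  refine TensorProduct.ext' fun a b => ?_
  simp only [LinearMap.comp_apply, LinearEquiv.coe_coe, flip₂_symm_tmul, idTensor_tmul,
    tensorId_tmul]
  rw [← reassoc_tmul_antiConj e he, antiConj_of_symm e he]
  rfl

theorem full_left_op (V : Submodule ℂ B)
    (hV : ∀ a b, (flip₂ e).conj H.T₂ (a ⊗ₜ b) ∈ LinearMap.range (V.subtype.rTensor B)) :
    V = ⊤ := by
  have key : ∀ w, (flip₂ e).symm (V.subtype.rTensor B w) ∈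
      LinearMap.range ((V.comap e.toLinearMap).subtype.lTensor A) := fun w => by
    induction w with
    | zero => simp
    | add x y hx hy => rw [map_add, map_add]; exact add_mem hx hy
    | tmul v b => exact ⟨e.symm b ⊗ₜ ⟨e.symm v.1, by simp⟩, by simp⟩
  have h := H.full_right (V.comap e.toLinearMap) fun c a => by
    obtain ⟨w, hw⟩ := hV (e a) (e c)
    have := key w
    rw [hw] at this
    simpa [LinearEquiv.conj_apply] using this
  rw [eq_top_iff]
  rintro x -
  have : e.symm x ∈ V.comap e.toLinearMap := h ▸ Submodule.mem_top
  simpa using this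

theorem full_right_op (V : Submodule ℂ B)
    (hV : ∀ a b, (flip₂ e).conj H.T₁ (a ⊗ₜ b) ∈ LinearMap.range (V.subtype.lTensor B)) :
    V = ⊤ := by
  have key : ∀ w, (flip₂ e).symm (V.subtype.lTensor B w) ∈
      LinearMap.range ((V.comap e.toLinearMap).subtype.rTensor A) := fun w => by
    induction w with
    | zero => simp
    | add x y hx hy => rw [map_add, map_add]; exact add_mem hx hy
    | tmul b v => exact ⟨⟨e.symm v.1, by simp⟩ ⊗ₜ e.symm b, by simp⟩
  have h := H.full_left (V.comap e.toLinearMap) fun a b => by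
    obtain ⟨w, hw⟩ := hV (e b) (e a)
    have := key w
    rw [hw] at this
    simpa [LinearEquiv.conj_apply] using this
  rw [eq_top_iff]
  rintro x -
  have : e.symm x ∈ V.comap e.toLinearMap := h ▸ Submodule.mem_top
  simpa using this

theorem span_mul_op (H : WeakMultiplierHopfAlgebra A) (e : A ≃ₗ[ℂ] B)
    (he : ∀ x y : A, e (x * y) = e y * e x) :
    Submodule.span ℂ {x : B | ∃ a b : B, x = a * b} = ⊤ := by
  rw [eq_top_iff]
  rintro x -
  have hx : e.symm x ∈ Submodule.span ℂ {x : A | ∃ a b : A, x = a * b} :=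
    H.idempotent ▸ Submodule.mem_top
  have := Submodule.mem_map_of_mem (f := e.toLinearMap) hx
  rw [Submodule.map_span] at this
  rw [LinearEquiv.coe_coe, LinearEquiv.apply_symm_apply] at this
  refine Submodule.span_mono ?_ this
  rintro _ ⟨_, ⟨a, b, rfl⟩, rfl⟩
  exact ⟨e b, e a, he a b⟩

theorem of_conj (T : A ⊗[ℂ] A →ₗ[ℂ] A ⊗[ℂ] A) (a b : B) :
    of ((flip₂ e).conj T (a ⊗ₜ b)) =
      antiConj (flip₂ e) (flip₂_mul e he) (of (T (e.symm b ⊗ₜ e.symm a))) := by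
  rw [antiConj_of, LinearEquiv.conj_apply_apply, flip₂_symm_tmul]

/-- The opposite weak multiplier Hopf algebra, on an algebra `B` anti-isomorphic to `A`, with the
opposite coproduct. The flip exchanges `T₁` with `T₂` and `G₁` with `G₂`, and left with right
multiplication by `E`. -/
def op : WeakMultiplierHopfAlgebra B where
  nondegenerate := IsNondegenerateProduct.of_antiEquiv e he H.nondegenerate
  idempotent := H.span_mul_op e he
  Δ := H.Δop e he
  T₁ := (flip₂ e).conj H.T₂
  of_T₁ a b := by
    rw [of_conj e he, H.of_T₂, antiConj_mul, antiConj_tmul e he, antiConj_one,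
      antiConj_of_symm e he, Δop_apply]
  T₂ := (flip₂ e).conj H.T₁
  of_T₂ c a := by
    rw [of_conj e he, H.of_T₁, antiConj_mul, antiConj_tmul e he, antiConj_one,
      antiConj_of_symm e he, Δop_apply]
  coassoc := by
    rw [leg12_conj, leg23_conj, ← LinearEquiv.conj_comp, ← LinearEquiv.conj_comp, H.coassoc]
  full_left V hV := H.full_left_op e V hV
  full_right V hV := H.full_right_op e V hV
  ε := H.ε ∘ₗ e.symm.toLinearMap
  counit_left a b := by
    rw [LinearEquiv.conj_apply_apply, flip₂_symm_tmul, sliceFst_flip₂, H.counit_right, he,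
      LinearEquiv.apply_symm_apply, LinearEquiv.apply_symm_apply]
  counit_right c a := by
    rw [LinearEquiv.conj_apply_apply, flip₂_symm_tmul, sliceSnd_flip₂, H.counit_left, he,
      LinearEquiv.apply_symm_apply, LinearEquiv.apply_symm_apply]
  E := antiConj (flip₂ e) (flip₂_mul e he) H.E
  E_mul_E := by rw [← antiConj_mul, H.E_mul_E]
  range_T₁ := by
    rw [left_antiConj, LinearEquiv.range_conj, LinearEquiv.range_conj, H.range_T₂]
  range_T₂ := by
    rw [right_antiConj, LinearEquiv.range_conj, LinearEquiv.range_conj, H.range_T₁]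
  E_comm := by
    rw [tensorOne_antiConj e he, oneTensor_antiConj e he, ← antiConj_mul, ← antiConj_mul, H.E_comm]
  tensorId_E := by
    rw [tensorId_Δop, tensorOne_antiConj e he, oneTensor_antiConj e he, ← antiConj_mul]
    exact H.idTensor_E.antiConj _ _ _ _
  idTensor_E := by
    rw [idTensor_Δop, tensorOne_antiConj e he, oneTensor_antiConj e he, ← antiConj_mul]
    exact H.tensorId_E.antiConj _ _ _ _
  G₁ := (flip₂ e).conj H.G₂
  G₁_spec := by
    rw [left_antiConj, leg12_conj, leg13_conj, leg23_conj, ← LinearEquiv.conj_comp,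
      ← LinearEquiv.conj_comp, H.G₂_spec]
  G₂ := (flip₂ e).conj H.G₁
  G₂_spec := by
    rw [right_antiConj, leg12_conj, leg13_conj, leg23_conj, ← LinearEquiv.conj_comp,
      ← LinearEquiv.conj_comp, H.G₁_spec]
  ker_T₁ := by
    rw [LinearEquiv.ker_conj, H.ker_T₂, ← LinearEquiv.range_conj, map_sub, LinearEquiv.conj_id]
  ker_T₂ := by
    rw [LinearEquiv.ker_conj, H.ker_T₁, ← LinearEquiv.range_conj, map_sub, LinearEquiv.conj_id]

end WeakMultiplierHopfAlgebra

namespace RegularWeakMultiplierHopfAlgebra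

variable (H : RegularWeakMultiplierHopfAlgebra A)
variable (e : A ≃ₗ[ℂ] B) (he : ∀ x y : A, e (x * y) = e y * e x)

theorem isAntipode_op : (H.toWeakMultiplierHopfAlgebra.op e he).IsAntipode
    (e.symm ≪≫ₗ H.S ≪≫ₗ e : B ≃ₗ[ℂ] B) := by
  obtain ⟨R₁, R₂, ⟨hE₁, hG₁, hR₁⟩, ⟨hE₂, hG₂, hR₂⟩, hS₁, hS₂⟩ := H.isAntipode
  refine ⟨(flip₂ e).conj R₂, (flip₂ e).conj R₁, ⟨?_, ?_, ?_⟩, ⟨?_, ?_, ?_⟩, fun a b => ?_,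
    fun a b => ?_⟩
  · exact ((flip₂ e).conj_comp _ _).symm.trans (congrArg _ hE₂)
  · exact ((flip₂ e).conj_comp _ _).symm.trans (congrArg _ hG₂)
  · refine Eq.trans ?_ (congrArg (flip₂ e).conj hR₂)
    simp only [LinearEquiv.conj_comp]
    rfl
  · exact ((flip₂ e).conj_comp _ _).symm.trans (congrArg _ hE₁)
  · exact ((flip₂ e).conj_comp _ _).symm.trans (congrArg _ hG₁)
  · refine Eq.trans ?_ (congrArg (flip₂ e).conj hR₁)
    simp only [LinearEquiv.conj_comp]
    rfl
  · rw [LinearEquiv.conj_apply_apply, flip₂_symm_tmul]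
    refine Eq.trans ?_ (sliceFst_flip₂ e H.ε _).symm
    rw [← hS₂, he]
    simp
  · rw [LinearEquiv.conj_apply_apply, flip₂_symm_tmul]
    refine Eq.trans ?_ (sliceSnd_flip₂ e H.ε _).symm
    rw [← hS₁, he]
    simp

/-- The opposite regular weak multiplier Hopf algebra, which has the same antipode. -/
def op : RegularWeakMultiplierHopfAlgebra B where
  toWeakMultiplierHopfAlgebra := H.toWeakMultiplierHopfAlgebra.op e he
  T₃ := (flip₂ e).conj H.T₄
  of_T₃ a b := by
    rw [of_conj e he, H.of_T₄, antiConj_mul, antiConj_tmul e he, antiConj_one,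
      antiConj_of_symm e he]
    rfl
  T₄ := (flip₂ e).conj H.T₃
  of_T₄ c a := by
    rw [of_conj e he, H.of_T₃, antiConj_mul, antiConj_tmul e he, antiConj_one,
      antiConj_of_symm e he]
    rfl
  S := e.symm ≪≫ₗ H.S ≪≫ₗ e
  isAntipode := H.isAntipode_op e he

end RegularWeakMultiplierHopfAlgebra

end Opposite

/-! ### Consequences of the passage to the opposite algebra -/

section Mirror

open Multiplier

variable {A : Type*} [NonUnitalRing A] [Module ℂ A] [IsScalarTower ℂ A A] [SMulCommClass ℂ A A]
variable {B : Type*} [NonUnitalRing B] [Module ℂ B] [IsScalarTower ℂ B B] [SMulCommClass ℂ B B]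

theorem rTensor_flip₂ (e : A ≃ₗ[ℂ] B) {f : B →ₗ[ℂ] B} {g : A →ₗ[ℂ] A}
    (h : ∀ a, f (e a) = e (g a)) (z : A ⊗[ℂ] A) :
    f.rTensor B (flip₂ e z) = flip₂ e (g.lTensor A z) := by
  induction z with
  | zero => simp
  | add x y hx hy => simp only [map_add, hx, hy]
  | tmul a b => simp [h]

theorem lTensor_flip₂ (e : A ≃ₗ[ℂ] B) {f : B →ₗ[ℂ] B} {g : A →ₗ[ℂ] A}
    (h : ∀ a, f (e a) = e (g a)) (z : A ⊗[ℂ] A) :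
    f.lTensor B (flip₂ e z) = flip₂ e (g.rTensor A z) := by
  induction z with
  | zero => simp
  | add x y hx hy => simp only [map_add, hx, hy]
  | tmul a b => simp [h]

theorem conj_flip₂_tmul (e : A ≃ₗ[ℂ] B) (T : A ⊗[ℂ] A →ₗ[ℂ] A ⊗[ℂ] A) (a b : A) :
    (flip₂ e).conj T (e a ⊗ₜ e b) = flip₂ e (T (b ⊗ₜ a)) := by
  simp [LinearEquiv.conj_apply_apply]

/-- The image of `rTensor_mulLeft_R₁` under the passage to the opposite algebra. -/
theorem WeakMultiplierHopfAlgebra.lTensor_mulRight_R₂_of_antiEquiv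
    (H : WeakMultiplierHopfAlgebra A) (e : A ≃ₗ[ℂ] B) (he : ∀ x y : A, e (x * y) = e y * e x)
    {R₂ : A ⊗[ℂ] A →ₗ[ℂ] A ⊗[ℂ] A} {S : A →ₗ[ℂ] A}
    (hE : H.T₂ ∘ₗ R₂ = H.E.right) (hG : R₂ ∘ₗ H.T₂ = H.G₂) (hR : R₂ ∘ₗ H.T₂ ∘ₗ R₂ = R₂)
    (hS : ∀ a b : A, b * S a = sliceSnd H.ε (R₂ (b ⊗ₜ a))) (a b c : A) :
    (mulRight ℂ b).lTensor A (R₂ (c ⊗ₜ a)) =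
      (mulLeft ℂ c ∘ₗ S).rTensor A (H.T₁ (a ⊗ₜ b)) := by
  have h := (H.op e he).rTensor_mulLeft_R₁ (R₁ := (flip₂ e).conj R₂) (S := e.conj S)
    (((flip₂ e).conj_comp _ _).symm.trans (congrArg _ hE))
    (((flip₂ e).conj_comp _ _).symm.trans (congrArg _ hG))
    (by
      refine Eq.trans ?_ (congrArg (flip₂ e).conj hR)
      simp only [LinearEquiv.conj_comp]
      rfl)
    (fun x y => by
      change e (S (e.symm x)) * y = sliceFst (H.ε ∘ₗ e.symm.toLinearMap)
        (flip₂ e (R₂ (e.symm y ⊗ₜ e.symm x)))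
      rw [sliceFst_flip₂, ← hS, he, LinearEquiv.apply_symm_apply])
    (e a) (e c) (e b)
  change (mulLeft ℂ (e b)).rTensor B ((flip₂ e).conj R₂ (e a ⊗ₜ e c)) =
    (mulRight ℂ (e c) ∘ₗ e.conj S).lTensor B ((flip₂ e).conj H.T₁ (e b ⊗ₜ e a)) at h
  rw [conj_flip₂_tmul, conj_flip₂_tmul, rTensor_flip₂ e (g := mulRight ℂ b) (by simp [he]),
    lTensor_flip₂ e (g := mulLeft ℂ c ∘ₗ S)
      (by simp [he, LinearEquiv.conj_apply_apply])] at h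
  exact (flip₂ e).injective h

/-- `R₂(c ⊗ a) = ∑ cS(a₍₁₎) ⊗ a₍₂₎`, with `b` covering `a₍₂₎`. -/
theorem WeakMultiplierHopfAlgebra.lTensor_mulRight_R₂ (H : WeakMultiplierHopfAlgebra A)
    {R₂ : A ⊗[ℂ] A →ₗ[ℂ] A ⊗[ℂ] A} {S : A →ₗ[ℂ] A}
    (hE : H.T₂ ∘ₗ R₂ = H.E.right) (hG : R₂ ∘ₗ H.T₂ = H.G₂) (hR : R₂ ∘ₗ H.T₂ ∘ₗ R₂ = R₂)
    (hS : ∀ a b : A, b * S a = sliceSnd H.ε (R₂ (b ⊗ₜ a))) (a b c : A) :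
    (mulRight ℂ b).lTensor A (R₂ (c ⊗ₜ a)) =
      (mulLeft ℂ c ∘ₗ S).rTensor A (H.T₁ (a ⊗ₜ b)) :=
  H.lTensor_mulRight_R₂_of_antiEquiv (MulOpposite.opLinearEquiv ℂ) (fun _ _ => rfl)
    hE hG hR hS a b c

namespace RegularWeakMultiplierHopfAlgebra

variable (H : RegularWeakMultiplierHopfAlgebra A)

theorem range_E_left_le_of_antiEquiv (e : A ≃ₗ[ℂ] B) (he : ∀ x y : A, e (x * y) = e y * e x) :
    LinearMap.range H.E.left ≤ LinearMap.range H.T₄ := by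
  have h := (H.op e he).range_E_right_le
  change LinearMap.range ((flip₂ e).conj H.E.left) ≤
    LinearMap.range ((flip₂ e).conj H.T₄) at h
  rw [LinearEquiv.range_conj, LinearEquiv.range_conj] at h
  exact (Submodule.map_le_map_iff_of_injective (flip₂ e).injective _ _).1 h

/-- `E(A ⊗ A) ⊆ Δ(A)(A ⊗ 1)`. -/
theorem range_E_left_le : LinearMap.range H.E.left ≤ LinearMap.range H.T₄ :=
  H.range_E_left_le_of_antiEquiv (MulOpposite.opLinearEquiv ℂ) (fun _ _ => rfl)

end RegularWeakMultiplierHopfAlgebra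

end Mirror

/-! ### The projection `G₂` is a right module map -/

section ModuleMap

open Multiplier

variable {A : Type*} [NonUnitalRing A] [Module ℂ A] [IsScalarTower ℂ A A] [SMulCommClass ℂ A A]

theorem lTensor_rTensor_apply {M N P Q : Type*} [AddCommGroup M] [Module ℂ M] [AddCommGroup N]
    [Module ℂ N] [AddCommGroup P] [Module ℂ P] [AddCommGroup Q] [Module ℂ Q] (f : M →ₗ[ℂ] P)
    (g : N →ₗ[ℂ] Q) (z : M ⊗[ℂ] N) :
    g.lTensor P (f.rTensor N z) = f.rTensor Q (g.lTensor M z) :=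
  LinearMap.congr_fun ((LinearMap.lTensor_comp_rTensor ..).trans
    (LinearMap.rTensor_comp_lTensor ..).symm) z

namespace RegularWeakMultiplierHopfAlgebra

variable (H : RegularWeakMultiplierHopfAlgebra A)

theorem rTensor_mulRight_T₂ (c a p : A) :
    (mulRight ℂ p).rTensor A (H.T₂ (c ⊗ₜ a)) = (mulLeft ℂ c).rTensor A (H.T₄ (p ⊗ₜ a)) := by
  apply of_injective H.nondegenerate.tensor
  change of ((tmul (of p) 1).right _) = of ((tmul (of c) 1).left _)
  rw [of_left H.nondegenerate.tensor, of_right H.nondegenerate.tensor, H.of_T₂, H.of_T₄,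
    mul_assoc]

theorem lTensor_mulRight_T₄ (p a q : A) :
    (mulRight ℂ q).lTensor A (H.T₄ (p ⊗ₜ a)) = (H.Δ a).left (p ⊗ₜ q) := by
  apply of_injective H.nondegenerate.tensor
  change of ((tmul 1 (of q)).right _) = _
  rw [of_right H.nondegenerate.tensor, of_left H.nondegenerate.tensor, H.of_T₄, mul_assoc,
    tmul_mul_tmul, one_mul, mul_one, tmul_of_of]

/-- The specification of `G₂`, multiplied from the right by `p ⊗ 1 ⊗ 1`: for `z = ∑ z₁ ⊗ z₂` in
`Δ(A)(A ⊗ 1)`, it says `∑ cz₁ ⊗ G₂(u ⊗ z₂) = ∑ (c ⊗ u)E(z₁ ⊗ 1) ⊗ z₂`. -/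
theorem lTensor_G₂_rTensor_mulLeft (c u : A) {z : A ⊗[ℂ] A}
    (hz : z ∈ LinearMap.range H.T₄) :
    (TensorProduct.assoc ℂ A A A).symm ((H.G₂ ∘ₗ TensorProduct.mk ℂ A A u).lTensor A
      ((mulLeft ℂ c).rTensor A z)) =
    ((LinearMap.rTensorHom A ∘ₗ (LinearMap.mul ℂ A).flip).flip
      (H.E.right (c ⊗ₜ u))).rTensor A z := by
  -- `K w z₁ = w(z₁ ⊗ 1)`
  let K := (LinearMap.rTensorHom A ∘ₗ (LinearMap.mul ℂ A).flip).flip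
  obtain ⟨y, rfl⟩ := hz
  induction y with
  | zero => simp
  | add x y hx hy => simp only [map_add, hx, hy]
  | tmul p a =>
    have h := congrArg (((mulRight ℂ p).rTensor A).rTensor A)
      (LinearMap.congr_fun H.G₂_spec (c ⊗ₜ u ⊗ₜ a))
    have h₁ : ∀ w, ((mulRight ℂ p).rTensor A).rTensor A
        (leg23 H.G₂ (TensorProduct.rightComm ℂ A A A (w ⊗ₜ u))) =
        (TensorProduct.assoc ℂ A A A).symm ((H.G₂ ∘ₗ TensorProduct.mk ℂ A A u).lTensor A
          ((mulRight ℂ p).rTensor A w)) := fun w => by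
      induction w with
      | zero => simp
      | add x y hx hy => simp only [TensorProduct.add_tmul, map_add, hx, hy]
      | tmul x y =>
        rw [TensorProduct.rightComm_tmul, leg23_tmul]
        have : ∀ t : A ⊗[ℂ] A, ((mulRight ℂ p).rTensor A).rTensor A
            ((TensorProduct.assoc ℂ A A A).symm (x ⊗ₜ t)) =
            (TensorProduct.assoc ℂ A A A).symm ((x * p) ⊗ₜ t) := fun t => by
          induction t with
          | zero => simp
          | add x y hx hy => simp only [TensorProduct.tmul_add, map_add, hx, hy]
          | tmul y z => simp
        rw [this]
        simp
    have h₂ : ∀ w, ((mulRight ℂ p).rTensor A).rTensor A (leg13 H.T₂ (w ⊗ₜ a)) =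
        (K w).rTensor A (H.T₄ (p ⊗ₜ a)) := fun w => by
      induction w with
      | zero => simp
      | add x y hx hy =>
        simp only [TensorProduct.add_tmul, map_add, hx, hy, LinearMap.rTensor_add,
          LinearMap.add_apply]
      | tmul x y =>
        have h₃ : ∀ t : A ⊗[ℂ] A, ((mulRight ℂ p).rTensor A).rTensor A
            (TensorProduct.rightComm ℂ A A A (t ⊗ₜ y)) =
            TensorProduct.rightComm ℂ A A A ((mulRight ℂ p).rTensor A t ⊗ₜ y) := fun t => by
          induction t with
          | zero => simp
          | add x y hx hy => simp only [TensorProduct.add_tmul, map_add, hx, hy]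
          | tmul y z => simp
        rw [leg13_tmul, h₃, rTensor_mulRight_T₂]
        generalize H.T₄ (p ⊗ₜ a) = t
        induction t with
        | zero => simp
        | add x y hx hy => simp only [TensorProduct.add_tmul, map_add, hx, hy]
        | tmul y z => simp [K]
    rw [LinearMap.comp_apply, LinearMap.comp_apply, leg13_tmul, h₁, leg12_tmul, h₂,
      rTensor_mulRight_T₂] at h
    exact h

/-- `G₂` commutes with right multiplication in the second leg. By its specification this holds on
the right leg of `Δ`, because `Δ(a)(p ⊗ q)` lies in `E(A ⊗ A) ⊆ Δ(A)(A ⊗ 1)`. -/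
theorem G₂_tmul_mul (u v q : A) :
    H.G₂ (u ⊗ₜ (v * q)) = (mulRight ℂ q).lTensor A (H.G₂ (u ⊗ₜ v)) := by
  let g : A →ₗ[ℂ] A ⊗[ℂ] A := H.G₂ ∘ₗ TensorProduct.mk ℂ A A u
  let D : A →ₗ[ℂ] A ⊗[ℂ] A := g ∘ₗ mulRight ℂ q - (mulRight ℂ q).lTensor A ∘ₗ g
  suffices hD : D = 0 from sub_eq_zero.1 (LinearMap.congr_fun hD v)
  refine H.eq_zero_of_right_leg D fun c a => H.nondegenerate.eq_of_rTensor_mulRight fun p => ?_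
  have hD : ∀ t, D.lTensor A t = g.lTensor A ((mulRight ℂ q).lTensor A t) -
      ((mulRight ℂ q).lTensor A).lTensor A (g.lTensor A t) := fun t => by
    rw [← LinearMap.lTensor_comp_apply, ← LinearMap.lTensor_comp_apply, ← LinearMap.sub_apply,
      ← LinearMap.lTensor_sub]
  rw [map_zero, ← lTensor_rTensor_apply, rTensor_mulRight_T₂, hD, sub_eq_zero]
  apply (TensorProduct.assoc ℂ A A A).symm.injective
  have h₁ : H.T₄ (p ⊗ₜ a) ∈ LinearMap.range H.T₄ := LinearMap.mem_range_self _ _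
  have h₂ : (mulRight ℂ q).lTensor A (H.T₄ (p ⊗ₜ a)) ∈ LinearMap.range H.T₄ := by
    rw [lTensor_mulRight_T₄, ← H.E_left_Δ_left]
    exact H.range_E_left_le (LinearMap.mem_range_self _ _)
  have h₄ : ∀ t : A ⊗[ℂ] (A ⊗[ℂ] A), (TensorProduct.assoc ℂ A A A).symm
      (((mulRight ℂ q).lTensor A).lTensor A t) =
      (mulRight ℂ q).lTensor (A ⊗[ℂ] A) ((TensorProduct.assoc ℂ A A A).symm t) := fun t => by
    induction t with
    | zero => simp
    | add x y hx hy => simp only [map_add, hx, hy]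
    | tmul x t =>
      induction t with
      | zero => simp
      | add x y hx hy => simp only [TensorProduct.tmul_add, map_add, hx, hy]
      | tmul y z => simp
  rw [lTensor_rTensor_apply, h₄, H.lTensor_G₂_rTensor_mulLeft c u h₁,
    H.lTensor_G₂_rTensor_mulLeft c u h₂, lTensor_rTensor_apply]

end RegularWeakMultiplierHopfAlgebra

end ModuleMap

/-! ### Left invariant functionals -/

section LeftInvariant

open Multiplier

variable {A : Type*} [NonUnitalRing A] [Module ℂ A] [IsScalarTower ℂ A A] [SMulCommClass ℂ A A]

theorem sliceThird_leg23_rightComm (φ : A →ₗ[ℂ] ℂ) (T : A ⊗[ℂ] A →ₗ[ℂ] A ⊗[ℂ] A)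
    (w : A ⊗[ℂ] A) (d : A) :
    sliceThird φ (leg23 T (TensorProduct.rightComm ℂ A A A (w ⊗ₜ d))) =
      (sliceSnd φ ∘ₗ T ∘ₗ TensorProduct.mk ℂ A A d).lTensor A w := by
  induction w with
  | zero => simp
  | add x y hx hy => simp only [TensorProduct.add_tmul, map_add, hx, hy]
  | tmul x y => rw [TensorProduct.rightComm_tmul, leg23_tmul, sliceThird_assoc_symm]; simp

namespace RegularWeakMultiplierHopfAlgebra

variable (H : RegularWeakMultiplierHopfAlgebra A)

theorem sndSliceΔ_right (φ : A →ₗ[ℂ] ℂ) (a c : A) :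
    (H.sndSliceΔ φ a).right c = sliceSnd φ (H.T₂ (c ⊗ₜ a)) := rfl

/-- For a left invariant `φ`, the maps `T₂` and `G₂` agree after slicing with `φ`. With
`x = (ι ⊗ φ)Δ(p)`, both give `(c ⊗ d)E(x ⊗ 1)` on the right leg of `Δ`. -/
theorem sliceSnd_T₂_eq_sliceSnd_G₂ {φ : A →ₗ[ℂ] ℂ} (hφ : H.IsLeftInvariant φ)
    (z : A ⊗[ℂ] A) : sliceSnd φ (H.T₂ z) = sliceSnd φ (H.G₂ z) := by
  refine LinearMap.congr_fun (f := sliceSnd φ ∘ₗ H.T₂) (g := sliceSnd φ ∘ₗ H.G₂)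
    (TensorProduct.ext' fun d v => ?_) z
  let D : A →ₗ[ℂ] A := sliceSnd φ ∘ₗ H.T₂ ∘ₗ TensorProduct.mk ℂ A A d -
    sliceSnd φ ∘ₗ H.G₂ ∘ₗ TensorProduct.mk ℂ A A d
  suffices hD : D = 0 from sub_eq_zero.1 (LinearMap.congr_fun hD v)
  refine H.eq_zero_of_right_leg D fun c p => ?_
  let x := H.sndSliceΔ φ p
  have hT : ∀ w, sliceThird φ (leg23 H.T₂ (leg13 H.T₂ (H.T₂ w ⊗ₜ p))) =
      x.right.rTensor A (H.T₂ w) := fun w => by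
    induction w with
    | zero => simp
    | add x y hx hy => simp only [TensorProduct.add_tmul, map_add, hx, hy]
    | tmul s r =>
      rw [H.pentagon_T₂, sliceThird_leg12, leg23_tmul, sliceThird_assoc_symm, ← sndSliceΔ_right,
        H.T₂_right_eq (H.Δ_right_eq (H.Δ_mul_of_mem (hφ p)) (H.E_mul_tmul_of_mem (hφ p)))]
  have hG : ∀ w, sliceThird φ (leg13 H.T₂ (w ⊗ₜ p)) = x.right.rTensor A w := fun w => by
    induction w with
    | zero => simp
    | add x y hx hy => simp only [TensorProduct.add_tmul, map_add, hx, hy]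
    | tmul s r => rw [leg13_tmul, sliceThird_rightComm]; rfl
  have hG₂ := congrArg (sliceThird φ) (LinearMap.congr_fun H.G₂_spec (c ⊗ₜ d ⊗ₜ p))
  rw [LinearMap.comp_apply, LinearMap.comp_apply, leg12_tmul, hG] at hG₂
  obtain ⟨w, hw⟩ := H.exists_T₂_eq_E_right (c ⊗ₜ d)
  rw [LinearMap.lTensor_sub, LinearMap.sub_apply, sub_eq_zero, ← sliceThird_leg23_rightComm,
    ← sliceThird_leg23_rightComm, ← leg13_tmul, hG₂, ← H.leg23_T₂_leg13_T₂_E_right, ← hw, hT]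

theorem sliceSnd_Δ_right (φ : A →ₗ[ℂ] ℂ) (b c a : A) :
    sliceSnd φ ((H.Δ b).right (c ⊗ₜ a)) = c * sliceSnd φ (H.T₃ (b ⊗ₜ a)) := by
  rw [← rTensor_mulLeft_T₃, sliceSnd_rTensor, LinearMap.mulLeft_apply]

/-- The formula for a left invariant functional. Apply `(ι ⊗ φ)T₂ = (ι ⊗ φ)G₂` to
`R₂(c ⊗ a)(1 ⊗ b)`, where `T₂R₂ = · E` and `G₂R₂ = R₂`. -/
theorem sliceSnd_T₃_eq {φ : A →ₗ[ℂ] ℂ} (hφ : H.IsLeftInvariant φ) (a b : A) :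
    sliceSnd φ (H.T₃ (b ⊗ₜ a)) = H.S (sliceSnd φ (H.T₁ (a ⊗ₜ b))) := by
  obtain ⟨R₁, R₂, -, ⟨hE, hG, hR⟩, -, hS⟩ := H.isAntipode
  rw [← sub_eq_zero]
  apply H.nondegenerate.2
  intro c
  have hT : ∀ w, (H.Δ b).right (H.T₂ w) = H.T₂ ((mulRight ℂ b).lTensor A w) := fun w => by
    induction w with
    | zero => simp
    | add x y hx hy => simp only [map_add, hx, hy]
    | tmul x y => simp [H.T₂_mul]
  have hM : ∀ w, H.G₂ ((mulRight ℂ b).lTensor A w) = (mulRight ℂ b).lTensor A (H.G₂ w) :=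
    fun w => by
      induction w with
      | zero => simp
      | add x y hx hy => simp only [map_add, hx, hy]
      | tmul x y => simp [G₂_tmul_mul]
  have h₁ : H.E.right (c ⊗ₜ a) = H.T₂ (R₂ (c ⊗ₜ a)) := (LinearMap.congr_fun hE _).symm
  have h₂ : H.G₂ (R₂ (c ⊗ₜ a)) = R₂ (c ⊗ₜ a) := by
    rw [← hG]
    exact LinearMap.congr_fun hR _
  rw [mul_sub, sub_eq_zero, ← sliceSnd_Δ_right, ← H.Δ_right_E_right, h₁, hT,
    H.sliceSnd_T₂_eq_sliceSnd_G₂ hφ, hM, h₂, H.lTensor_mulRight_R₂ hE hG hR hS, sliceSnd_rTensor]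
  rfl

/-- If `φ` satisfies the formula, then `(ι ⊗ φ)Δ(ab) = ε_t((ι ⊗ φ)(Δ(a)(1 ⊗ b)))`. -/
theorem sndSliceΔ_mul {φ : A →ₗ[ℂ] ℂ}
    (hφ : ∀ a b : A, sliceSnd φ (H.T₃ (b ⊗ₜ a)) = H.S (sliceSnd φ (H.T₁ (a ⊗ₜ b)))) (a b : A) :
    H.sndSliceΔ φ (a * b) = H.target (sliceSnd φ (H.T₁ (a ⊗ₜ b))) := by
  refine ext_right H.nondegenerate (LinearMap.ext fun c => ?_)
  have h : H.T₂ (c ⊗ₜ sliceSnd φ (H.T₁ (a ⊗ₜ b))) =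
      sliceThird φ (leg23 H.T₁ (H.T₂ (c ⊗ₜ a) ⊗ₜ b)) := by
    rw [← leg12_tmul, ← H.leg12_T₂_leg23_T₁, sliceThird_leg12, leg23_tmul, sliceThird_assoc_symm]
  rw [sndSliceΔ_right, target_right, h, H.T₂_mul]
  generalize H.T₂ (c ⊗ₜ a) = w
  induction w with
  | zero => simp
  | add x y hx hy => simp only [TensorProduct.add_tmul, map_add, hx, hy]
  | tmul p q =>
    rw [sliceSnd_Δ_right, hφ, leg23_tmul, sliceThird_assoc_symm]
    simp

/-- The elements `(ι ⊗ φ)Δ(a)` depend linearly on `a`, and `A² = A`. -/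
theorem sndSliceΔ_mem_targetImage {φ : A →ₗ[ℂ] ℂ}
    (hφ : ∀ a b : A, sliceSnd φ (H.T₃ (b ⊗ₜ a)) = H.S (sliceSnd φ (H.T₁ (a ⊗ₜ b)))) (a : A) :
    H.sndSliceΔ φ a ∈ H.targetImage := by
  have ha : a ∈ Submodule.span ℂ {x : A | ∃ a b, x = a * b} := H.idempotent ▸ Submodule.mem_top
  induction ha using Submodule.span_induction with
  | zero => exact ⟨0, fun c => by simp [sndSliceΔ_right]⟩
  | add a b _ _ ha hb =>
    obtain ⟨x, hx⟩ := ha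
    obtain ⟨y, hy⟩ := hb
    refine ⟨x + y, fun c => ?_⟩
    rw [TensorProduct.tmul_add, map_add, map_add, map_add, ← hx, ← hy]
    simp [sndSliceΔ_right, TensorProduct.tmul_add]
  | smul r a _ ha =>
    obtain ⟨x, hx⟩ := ha
    refine ⟨r • x, fun c => ?_⟩
    rw [TensorProduct.tmul_smul, map_smul, map_smul, map_smul, ← hx]
    simp [sndSliceΔ_right, TensorProduct.tmul_smul]
  | mem a h =>
    obtain ⟨a, b, rfl⟩ := h
    exact H.mem_targetImage.2 ⟨_, (H.sndSliceΔ_mul hφ a b).symm⟩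

theorem isLeftInvariant_iff (φ : A →ₗ[ℂ] ℂ) : H.IsLeftInvariant φ ↔
    ∀ a b : A, sliceSnd φ (H.T₃ (b ⊗ₜ a)) = H.S (sliceSnd φ (H.T₁ (a ⊗ₜ b))) :=
  ⟨fun h a b => H.sliceSnd_T₃_eq h a b,
    fun h a => H.targetImage_subset (H.sndSliceΔ_mem_targetImage h a)⟩

end RegularWeakMultiplierHopfAlgebra

end LeftInvariant

/-! ### Right invariant functionals -/

section RightInvariant

open Multiplier

variable {A : Type*} [NonUnitalRing A] [Module ℂ A] [IsScalarTower ℂ A A] [SMulCommClass ℂ A A]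
variable {B : Type*} [NonUnitalRing B] [Module ℂ B] [IsScalarTower ℂ B B] [SMulCommClass ℂ B B]

namespace RegularWeakMultiplierHopfAlgebra

variable (H : RegularWeakMultiplierHopfAlgebra A)
variable (e : A ≃ₗ[ℂ] B) (he : ∀ x y : A, e (x * y) = e y * e x)

theorem sndSliceΔ_op (ψ : A →ₗ[ℂ] ℂ) (a : A) :
    (H.op e he).sndSliceΔ (ψ ∘ₗ e.symm.toLinearMap) (e a) = antiConj e he (H.fstSliceΔ ψ a) := by
  refine ext_right (H.op e he).nondegenerate (LinearMap.ext fun c => ?_)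
  obtain ⟨c, rfl⟩ := e.surjective c
  rw [sndSliceΔ_right, right_antiConj, LinearEquiv.conj_apply_apply]
  change sliceSnd _ ((flip₂ e).conj H.T₁ (e c ⊗ₜ e a)) = _
  rw [conj_flip₂_tmul, sliceSnd_flip₂, LinearEquiv.symm_apply_apply]
  rfl

theorem mul'_flip₂ (he : ∀ x y : A, e (x * y) = e y * e x) (z : A ⊗[ℂ] A) :
    mul' ℂ B (flip₂ e z) = e (mul' ℂ A z) := by
  induction z with
  | zero => simp
  | add x y hx hy => simp only [map_add, hx, hy]
  | tmul a b => simp [he]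

/-- The passage to the opposite algebra exchanges `ε_s(A)` with `ε_t(A)`. -/
theorem antiConj_mem_targetImage_op (x : Multiplier A) :
    antiConj e he x ∈ (H.op e he).targetImage ↔ x ∈ H.sourceImage := by
  have key : ∀ a c : A, mul' ℂ B (((H.op e he).S : B →ₗ[ℂ] B).lTensor B
      ((H.op e he).T₂ (e c ⊗ₜ e a))) =
      e (mul' ℂ A ((H.S : A →ₗ[ℂ] A).rTensor A (H.T₁ (a ⊗ₜ c)))) := fun a c => by
    change mul' ℂ B (((e.symm ≪≫ₗ H.S ≪≫ₗ e : B ≃ₗ[ℂ] B) : B →ₗ[ℂ] B).lTensor B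
      ((flip₂ e).conj H.T₁ (e c ⊗ₜ e a))) = _
    rw [conj_flip₂_tmul, lTensor_flip₂ e (g := (H.S : A →ₗ[ℂ] A)) (by simp), mul'_flip₂ e he]
  constructor
  · rintro ⟨a, ha⟩
    obtain ⟨a, rfl⟩ := e.surjective a
    refine ⟨a, fun c => e.injective ?_⟩
    rw [← key, ← ha]
    simp [LinearEquiv.conj_apply_apply]
  · rintro ⟨a, ha⟩
    refine ⟨e a, fun c => ?_⟩
    obtain ⟨c, rfl⟩ := e.surjective c
    rw [key, ← ha]
    simp [LinearEquiv.conj_apply_apply]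

theorem antiConj_mem_targetMultiplier_op (x : Multiplier A) :
    antiConj e he x ∈ (H.op e he).targetMultiplier ↔ x ∈ H.sourceMultiplier := by
  constructor
  · intro h y hy
    have := h _ ((H.antiConj_mem_targetImage_op e he y).2 hy)
    rw [← antiConj_mul, ← antiConj_mul, antiConj_mem_targetImage_op,
      antiConj_mem_targetImage_op] at this
    exact this.symm
  · intro h y hy
    obtain ⟨y, rfl⟩ := antiConj_surjective e he y
    have := h y ((H.antiConj_mem_targetImage_op e he y).1 hy)
    rw [← antiConj_mul, ← antiConj_mul, antiConj_mem_targetImage_op,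
      antiConj_mem_targetImage_op]
    exact this.symm

theorem isLeftInvariant_op (ψ : A →ₗ[ℂ] ℂ) :
    (H.op e he).IsLeftInvariant (ψ ∘ₗ e.symm.toLinearMap) ↔ H.IsRightInvariant ψ := by
  refine e.surjective.forall.trans (forall_congr' fun a => ?_)
  rw [sndSliceΔ_op, antiConj_mem_targetMultiplier_op]

theorem isRightInvariant_iff_of_antiEquiv (he : ∀ x y : A, e (x * y) = e y * e x)
    (ψ : A →ₗ[ℂ] ℂ) : H.IsRightInvariant ψ ↔
    ∀ a b : A, sliceFst ψ (H.T₄ (b ⊗ₜ a)) = H.S (sliceFst ψ (H.T₂ (a ⊗ₜ b))) := by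
  rw [← H.isLeftInvariant_op e he, isLeftInvariant_iff]
  refine (e.surjective.forall.trans (forall_congr' fun a =>
    e.surjective.forall.trans (forall_congr' fun b => ?_))).trans forall_comm
  change sliceSnd _ ((flip₂ e).conj H.T₄ (e b ⊗ₜ e a)) =
    e (H.S (e.symm (sliceSnd _ ((flip₂ e).conj H.T₂ (e a ⊗ₜ e b))))) ↔
    sliceFst ψ (H.T₄ (a ⊗ₜ b)) = H.S (sliceFst ψ (H.T₂ (b ⊗ₜ a)))
  rw [conj_flip₂_tmul, conj_flip₂_tmul, sliceSnd_flip₂, sliceSnd_flip₂,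
    LinearEquiv.symm_apply_apply, e.injective.eq_iff]

theorem fstSliceΔ_mem_sourceImage_of_antiEquiv (he : ∀ x y : A, e (x * y) = e y * e x)
    {ψ : A →ₗ[ℂ] ℂ} (hψ : H.IsRightInvariant ψ) (a : A) : H.fstSliceΔ ψ a ∈ H.sourceImage := by
  rw [← H.antiConj_mem_targetImage_op e he, ← sndSliceΔ_op]
  exact (H.op e he).sndSliceΔ_mem_targetImage
    ((isLeftInvariant_iff _ _).1 ((H.isLeftInvariant_op e he ψ).2 hψ)) (e a)

end RegularWeakMultiplierHopfAlgebra

end RightInvariant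

end

theorem mainTheorem5 {A : Type*} [NonUnitalRing A] [Module ℂ A] [IsScalarTower ℂ A A]
    [SMulCommClass ℂ A A] (H : RegularWeakMultiplierHopfAlgebra A) :
    (∀ φ : A →ₗ[ℂ] ℂ, H.IsLeftInvariant φ ↔
      ∀ a b : A, sliceSnd φ (H.T₃ (b ⊗ₜ[ℂ] a)) = H.S (sliceSnd φ (H.T₁ (a ⊗ₜ[ℂ] b)))) ∧
    (∀ ψ : A →ₗ[ℂ] ℂ, H.IsRightInvariant ψ ↔
      ∀ a b : A, sliceFst ψ (H.T₄ (b ⊗ₜ[ℂ] a)) = H.S (sliceFst ψ (H.T₂ (a ⊗ₜ[ℂ] b)))) ∧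
    (∀ φ : A →ₗ[ℂ] ℂ, H.IsLeftInvariant φ → ∀ a : A, H.sndSliceΔ φ a ∈ H.targetImage) ∧
    (∀ ψ : A →ₗ[ℂ] ℂ, H.IsRightInvariant ψ → ∀ a : A, H.fstSliceΔ ψ a ∈ H.sourceImage) :=
  ⟨H.isLeftInvariant_iff,
    H.isRightInvariant_iff_of_antiEquiv (MulOpposite.opLinearEquiv ℂ) fun _ _ => rfl,
    fun φ hφ => H.sndSliceΔ_mem_targetImage ((H.isLeftInvariant_iff φ).1 hφ),
    fun _ hψ => H.fstSliceΔ_mem_sourceImage_of_antiEquiv (MulOpposite.opLinearEquiv ℂ)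
      (fun _ _ => rfl) hψ⟩
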